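/- **Setting.** Let $(E_p,\mathcal E_p)_{p\ge 0}$ be measurable spaces, let $(X_p)_{p\ge0}$ be a Markov chain with $X_p\in E_p$, fixed initial value $X_0=x_0$ and Markov transitions $K_{p}$ from $E_{p-1}$ to $E_{p}$, and put $F_p=E_0\times\dots\times E_p$, $Y_p=(X_0,\dots,X_p)$; let $M_p$ be the Markov transition of $Y$ from $F_{p-1}$ to $F_p$. Let $G_p:F_p\to(0,\infty)$, $p\ge1$, be measurable with $\sup_{y,y'\in F_p}G_p(y)/G_p(y')<\infty$. For bounded measurable $f$ on $F_p$ set $$\gamma_p(f)=\mathbb E\Big[f(Y_p)\prod_{1\le k<p}G_k(Y_k)\Big],\qquad \eta_p(f)=\gamma_p(f)/\gamma_p(1),$$ and let $\gamma_p^-,\eta_p^-$ be defined in the same way with $G_k$ replaced by $1/G_k$. **Particle system.** For a probability measure $\eta$ on $F_{p}$, $p\ge1$, let $\Phi_{p+1}(\eta)=\int\eta(dy)\,G_{p}(y)\,M_{p+1}(y,\cdot)/\eta(G_{p})$. For $N\ge1$ let $\xi_p=(\xi_p^1,\dots,\xi_p^N)\in F_p^N$, $p\ge1$, be the Markov chain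 such that $\xi_1^1,\dots,\xi_1^N$ are i.i.d. with law $M_1(x_0,\cdot)$ and, given $\xi_1,\dots,\xi_p$, the particles $\xi_{p+1}^1,\dots,\xi_{p+1}^N$ are i.i.d. with law $\Phi_{p+1}(\eta_p^N)$, where $\eta_p^N=\frac1N\sum_{i=1}^N\delta_{\xi_p^i}$. **Estimators.** Let $n\ge1$, let $V_n:E_n\to\mathbb R$ be measurable, and let $a\in\mathbb R$ be such that $P_n(a)=\mathbb P(V_n(X_n)\ge a)>0$. For bounded measurable $\varphi:F_n\to\mathbb R$ put $$T_n^{(a)}(\varphi)(x_0,\dots,x_n)=\varphi(x_0,\dots,x_n)\,\mathbf 1_{V_n(x_n)\ge a}\prod_{1\le p<n}G_p(x_0,\dots,x_p)^{-1},$$ $$P_n(a,\varphi)=\mathbb E[\varphi(X_0,\dots,X_n)\mid V_n(X_n)\ge a],$$ $$P_n^N(a)=\eta_n^N(T_n^{(a)}(1))\prod_{1\le p<n}\eta_p^N(G_p),\qquad P_n^N(a,\varphi)=\frac{\eta_n^N(T_n^{(a)}(\varphi))}{\eta_n^N(T_n^{(a)}(1))},$$ with $P_n^N(a,\varphi)=0$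 when the denominator vanishes. For $1\le p\le n$ let $$P_{p,n}(a)(x_p)=\mathbb P(V_n(X_n)\ge a\mid X_p=x_p),$$ $$P_{p,n}(a,\varphi)(x_0,\dots,x_p)=\mathbb E\big[(\varphi(X_0,\dots,X_n)-P_n(a,\varphi))\mathbf 1_{V_n(X_n)\ge a}\,\big|\,(X_0,\dots,X_p)=(x_0,\dots,x_p)\big],$$ where the conditional laws are those given by the transitions $K_p$; $P_{p,n}(a)$ is regarded as a function on $F_p$ through the last coordinate. **Theorem.** For every $n\ge1$ and every bounded measurable $\varphi:F_n\to\mathbb R$, $$\lim_{N\to\infty}N\,\mathbb E\big[(P_n^N(a,\varphi)-P_n(a,\varphi))\,\mathbf 1_{P_n^N(a)>0}\big]=-P_n(a)^{-2}\sum_{p=1}^n\gamma_p(1)\,\gamma_p^-(1)\,\eta_p^-\big[P_{p,n}(a)\,P_{p,n}(a,\varphi)\big].$$ -/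

import Mathlib

open MeasureTheory ProbabilityTheory Filter Topology

namespace RareEvent

/-- The path space `F_n = E_0 × ... × E_n`. -/
abbrev Path (E : ℕ → Type*) (n : ℕ) : Type _ := (i : Finset.Iic n) → E i

/-- The terminal point `x_n` of a path `(x_0, ..., x_n)`. -/
def Path.last {E : ℕ → Type*} {n : ℕ} (y : Path E n) : E n := y ⟨n, by simp⟩

/-- The initial segment `(x_0, ..., x_p)` of a path `(x_0, ..., x_n)`, for `p ≤ n`. -/
def Path.trunc {E : ℕ → Type*} {p n : ℕ} (h : p ≤ n) (y : Path E n) : Path E p :=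
  Preorder.frestrictLe₂ (π := E) h y

lemma Path.measurable_last {E : ℕ → Type*} [∀ n, MeasurableSpace (E n)] {n : ℕ} :
    Measurable (Path.last : Path E n → E n) :=
  measurable_pi_apply _

/-- A (time-inhomogeneous) Markov chain `X_n ∈ E_n` with deterministic initial value `x₀` and
transitions `K n` from `E_n` to `E_{n+1}`, together with positive potentials `G_p` on the path
spaces `F_p` such that `sup G_p(y) / G_p(y') < ∞`.
Only the potentials `G_p` with `p ≥ 1` matter. `G 0` is a dummy (one may take `G 0 = 1`): all the
products below start at `p = 1`, and the selection at time `0` acts on `N` copies of `x₀`. -/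
structure Model (E : ℕ → Type*) [∀ n, MeasurableSpace (E n)] where
  /-- initial value of the chain -/
  x₀ : E 0
  /-- transition of the chain from time `n` to time `n + 1` -/
  K : (n : ℕ) → Kernel (E n) (E (n + 1))
  /-- potentials on path space -/
  G : (p : ℕ) → Path E p → ℝ
  markov : ∀ n, IsMarkovKernel (K n)
  measurable_G : ∀ p, Measurable (G p)
  G_pos : ∀ p y, 0 < G p y
  G_ratio : ∀ p, ∃ C : ℝ, ∀ y y', G p y / G p y' ≤ C

namespace Model

variable {E : ℕ → Type*} [∀ n, MeasurableSpace (E n)] (M : Model E)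

/-- The same chain, with the potentials `G_p` replaced by `G_p⁻ = 1 / G_p`. -/
noncomputable def inv : Model E where
  x₀ := M.x₀
  K := M.K
  G p y := (M.G p y)⁻¹
  markov := M.markov
  measurable_G p := (M.measurable_G p).inv
  G_pos p y := inv_pos.2 (M.G_pos p y)
  G_ratio p := by
    obtain ⟨C, hC⟩ := M.G_ratio p
    refine ⟨C, fun y y' => ?_⟩
    rw [inv_div_inv]
    exact hC y' y

/-! ### The Markov chain -/

/-- The law of `X_{n+1}` given `(X_0, ..., X_n)`, which is `K n (X_n, ·)`. -/
noncomputable def stepKernel (n : ℕ) : Kernel (Path E n) (E (n + 1)) :=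
  (M.K n).comap Path.last Path.measurable_last

instance (n : ℕ) : IsMarkovKernel (M.stepKernel n) := by
  have := M.markov n
  unfold stepKernel
  infer_instance

/-- The path `(x₀)` of length `0`. -/
def startPath : Path E 0 := uniqueElim (ι := Finset.Iic 0) (α := fun i => E i) M.x₀

lemma last_startPath : M.startPath.last = M.x₀ := rfl

/-- The law of the whole trajectory `(X_n)_{n ≥ 0}` on the canonical space `∏ E_n`. The chain is the
coordinate process, and `Preorder.frestrictLe n x` is the path `Y_n = (X_0, ..., X_n)`. -/
noncomputable def law : Measure ((n : ℕ) → E n) :=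
  Kernel.traj M.stepKernel 0 M.startPath

/-- The law of the whole trajectory `(X_n)_{n ≥ 0}` given `(X_0, ..., X_p) = y`. -/
noncomputable def lawGiven (p : ℕ) (y : Path E p) : Measure ((n : ℕ) → E n) :=
  Kernel.traj M.stepKernel p y

/-- The Markov transition of the historical process `Y_n = (X_0, ..., X_n)` from time `n` to time
`n + 1`. -/
noncomputable def pathKernel (n : ℕ) : Kernel (Path E n) (Path E (n + 1)) :=
  Kernel.partialTraj M.stepKernel n (n + 1)

instance (n : ℕ) : IsMarkovKernel (M.pathKernel n) := by
  unfold pathKernel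
  infer_instance

/-- The transition probabilities `P(X_n ∈ · | X_p = x)` of the chain from time `p` to time `n`
(for `p ≤ n`): the composition of `K p, ..., K (n - 1)`. -/
noncomputable def transition {p n : ℕ} (h : p ≤ n) : Kernel (E p) (E n) :=
  Nat.leRec (motive := fun m _ => Kernel (E p) (E m)) Kernel.id (fun m _ κ => M.K m ∘ₖ κ) h

/-! ### Feynman-Kac measures and the rare event -/

/-- `γ_n(f) = E[f(Y_n) ∏_{1 ≤ k < n} G_k(Y_k)]`. -/
noncomputable def gamma (n : ℕ) (f : Path E n → ℝ) : ℝ :=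
  ∫ x, f (Preorder.frestrictLe n x) *
    ∏ k ∈ Finset.Ico 1 n, M.G k (Preorder.frestrictLe k x) ∂M.law

/-- `η_n(f) = γ_n(f) / γ_n(1)`. -/
noncomputable def eta (n : ℕ) (f : Path E n → ℝ) : ℝ :=
  M.gamma n f / M.gamma n (fun _ => 1)

/-- `γ_n⁻`, defined as `γ_n` with the potentials replaced by their inverses. -/
noncomputable def gammaInv (n : ℕ) (f : Path E n → ℝ) : ℝ := M.inv.gamma n f

/-- `η_n⁻`, defined as `η_n` with the potentials replaced by their inverses. -/
noncomputable def etaInv (n : ℕ) (f : Path E n → ℝ) : ℝ := M.inv.eta n f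

/-- The event `{V_n(X_n) ≥ a}` on the trajectory space. -/
def rareEvent {n : ℕ} (V : E n → ℝ) (a : ℝ) : Set ((n : ℕ) → E n) := {x | a ≤ V (x n)}

/-- `P_n(a) = P(V_n(X_n) ≥ a)`. -/
noncomputable def prob {n : ℕ} (V : E n → ℝ) (a : ℝ) : ℝ := M.law.real (rareEvent V a)

/-- `P_n(a, φ) = E[φ(X_0, ..., X_n) | V_n(X_n) ≥ a]`. -/
noncomputable def condMean {n : ℕ} (V : E n → ℝ) (a : ℝ) (φ : Path E n → ℝ) : ℝ :=
  ∫ x, φ (Preorder.frestrictLe n x) ∂(ProbabilityTheory.cond M.law (rareEvent V a))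

/-- `P_{p,n}(a)(x) = P(V_n(X_n) ≥ a | X_p = x)`. -/
noncomputable def probGiven {p n : ℕ} (h : p ≤ n) (V : E n → ℝ) (a : ℝ) (x : E p) : ℝ :=
  (M.transition h x).real {z | a ≤ V z}

/-- `P_{p,n}(a, φ)(y) = E[(φ(X_0, ..., X_n) - P_n(a, φ)) 1_{V_n(X_n) ≥ a} | (X_0, ..., X_p) = y]`. -/
noncomputable def centredGiven (p : ℕ) {n : ℕ} (V : E n → ℝ) (a : ℝ) (φ : Path E n → ℝ)
    (y : Path E p) : ℝ :=
  ∫ x, (rareEvent V a).indicator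
    (fun x => φ (Preorder.frestrictLe n x) - M.condMean V a φ) x ∂(M.lawGiven p y)

/-- `T_n^{(a)}(φ)(y) = φ(y) 1_{V_n(y_n) ≥ a} ∏_{1 ≤ p < n} G_p(y_0, ..., y_p)⁻¹`. -/
noncomputable def weight {n : ℕ} (V : E n → ℝ) (a : ℝ) (φ : Path E n → ℝ) (y : Path E n) : ℝ :=
  {y : Path E n | a ≤ V y.last}.indicator φ y *
    ∏ p : Finset.Ico 1 n, (M.G p (y.trunc (Finset.mem_Ico.1 p.2).2.le))⁻¹

/-! ### The interacting path-particle system -/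

/-- The empirical measure `m(ξ) = (1/N) ∑ δ_{ξ^i}` of `N` points. -/
noncomputable def empirical {F : Type*} [MeasurableSpace F] {N : ℕ} (ξ : Fin N → F) : Measure F :=
  (N : ENNReal)⁻¹ • ∑ i, Measure.dirac (ξ i)

/-- The selection/mutation map
`Φ_{n+1}(η) = ∫ η(dy) G_n(y) M_{n+1}(y, ·) / η(G_n)` from measures on `F_n` to measures on
`F_{n+1}`. -/
noncomputable def Phi (n : ℕ) (η : Measure (Path E n)) : Measure (Path E (n + 1)) :=
  (∫⁻ y, ENNReal.ofReal (M.G n y) ∂η)⁻¹ •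
    (η.withDensity fun y => ENNReal.ofReal (M.G n y)).bind (M.pathKernel n)

lemma lintegral_empirical {F : Type*} [MeasurableSpace F] {N : ℕ} (ξ : Fin N → F)
    {f : F → ENNReal} (hf : Measurable f) :
    ∫⁻ y, f y ∂(empirical ξ) = (N : ENNReal)⁻¹ * ∑ i, f (ξ i) := by
  simp [empirical, lintegral_dirac' _ hf]

lemma Phi_apply (n : ℕ) (η : Measure (Path E n)) {s : Set (Path E (n + 1))}
    (hs : MeasurableSet s) :
    M.Phi n η s = (∫⁻ y, ENNReal.ofReal (M.G n y) ∂η)⁻¹ *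
      ∫⁻ y, ENNReal.ofReal (M.G n y) * M.pathKernel n y s ∂η := by
  rw [Phi, Measure.smul_apply, smul_eq_mul,
    Measure.bind_apply hs (M.pathKernel n).measurable.aemeasurable,
    lintegral_withDensity_eq_lintegral_mul _ (M.measurable_G n).ennreal_ofReal
      ((M.pathKernel n).measurable_coe hs)]
  rfl

lemma isProbabilityMeasure_Phi_empirical (n : ℕ) {N : ℕ} (hN : N ≠ 0) (ξ : Fin N → Path E n) :
    IsProbabilityMeasure (M.Phi n (empirical ξ)) := by
  have hN' : (N : ENNReal)⁻¹ ≠ 0 := by simp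
  refine ⟨?_⟩
  rw [M.Phi_apply n _ MeasurableSet.univ]
  simp only [measure_univ, mul_one]
  rw [lintegral_empirical ξ (M.measurable_G n).ennreal_ofReal]
  apply ENNReal.inv_mul_cancel
  · refine mul_ne_zero hN' fun h => ?_
    rw [Finset.sum_eq_zero_iff] at h
    have := h ⟨0, Nat.pos_of_ne_zero hN⟩ (Finset.mem_univ _)
    rw [ENNReal.ofReal_eq_zero] at this
    exact absurd (M.G_pos n _) (not_lt.2 this)
  · refine ENNReal.mul_ne_top (by simpa using hN) ?_
    exact (ENNReal.sum_lt_top.2 fun i _ => ENNReal.ofReal_lt_top).ne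

instance (n N : ℕ) (ξ : Fin N → Path E n) :
    IsProbabilityMeasure (Measure.pi fun _ : Fin N => M.Phi n (empirical ξ)) := by
  rcases eq_or_ne N 0 with rfl | hN
  · rw [Measure.pi_of_empty]
    infer_instance
  · have := M.isProbabilityMeasure_Phi_empirical n hN ξ
    infer_instance

lemma measurable_Phi_empirical (n N : ℕ) {s : Set (Path E (n + 1))} (hs : MeasurableSet s) :
    Measurable fun ξ : Fin N → Path E n => M.Phi n (empirical ξ) s := by
  have hG := (M.measurable_G n).ennreal_ofReal
  have hK := (M.pathKernel n).measurable_coe hs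
  have hGK : Measurable fun y => ENNReal.ofReal (M.G n y) * M.pathKernel n y s := hG.mul hK
  simp only [M.Phi_apply n _ hs, lintegral_empirical _ hG, lintegral_empirical _ hGK]
  have h1 : Measurable fun ξ : Fin N → Path E n => ∑ i, ENNReal.ofReal (M.G n (ξ i)) :=
    Finset.measurable_sum _ fun i _ => hG.comp (measurable_pi_apply i)
  have h2 : Measurable fun ξ : Fin N → Path E n =>
      ∑ i, ENNReal.ofReal (M.G n (ξ i)) * M.pathKernel n (ξ i) s :=
    Finset.measurable_sum _ fun i _ => hGK.comp (measurable_pi_apply i)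
  exact (h1.const_mul _).inv.mul (h2.const_mul _)

/-- The transition of the particle system from time `n` to time `n + 1`: given `ξ_n`, the `N`
particles `ξ_{n+1}^j` are independent with common law `Φ_{n+1}(m(ξ_n))`. -/
noncomputable def particleKernel (N n : ℕ) : Kernel (Fin N → Path E n) (Fin N → Path E (n + 1)) where
  toFun ξ := Measure.pi fun _ => M.Phi n (empirical ξ)
  measurable' := by
    refine Measurable.measure_of_isPiSystem_of_isProbabilityMeasure generateFrom_pi.symm
      isPiSystem_pi ?_
    rintro _ ⟨t, ht, rfl⟩
    rcases eq_or_ne N 0 with rfl | hN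
    · exact Subsingleton.measurable
    · have := fun ξ => M.isProbabilityMeasure_Phi_empirical n hN ξ
      simp_rw [Measure.pi_pi]
      exact Finset.measurable_prod _ fun j _ =>
        M.measurable_Phi_empirical n N (ht j (Set.mem_univ j))

instance (N n : ℕ) : IsMarkovKernel (M.particleKernel N n) :=
  ⟨fun ξ => inferInstanceAs (IsProbabilityMeasure (Measure.pi fun _ => M.Phi n (empirical ξ)))⟩

/-- Trajectories `(ξ_n)_{n ≥ 0}` of the particle system; `ξ n i` is the `i`-th path-particle at
time `n`. -/
abbrev Swarm (E : ℕ → Type*) (N : ℕ) : Type _ := (n : ℕ) → Fin N → Path E n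

/-- The law of the particle system `(ξ_n)_{n ≥ 0}` with `N` particles: the Markov chain with
transitions `particleKernel N n` whose `N` particles all sit at the path `(x₀)` at time `0`. -/
noncomputable def particleLaw (N : ℕ) : Measure (Swarm E N) :=
  Kernel.traj (X := fun n => Fin N → Path E n)
    (fun n => (M.particleKernel N n).comap (fun ξ => ξ ⟨n, by simp⟩) (measurable_pi_apply _))
    0 (fun i _ => M.startPath.trunc (Finset.mem_Iic.1 i.2))

/-- `η_n^N(f) = m(ξ_n)(f)`. -/
noncomputable def etaN {N : ℕ} (ξ : Swarm E N) (n : ℕ) (f : Path E n → ℝ) : ℝ :=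
  ∫ y, f y ∂(empirical (ξ n))

/-- `γ_n^N(f) = η_n^N(f) ∏_{1 ≤ p < n} η_p^N(G_p)`. -/
noncomputable def gammaN {N : ℕ} (ξ : Swarm E N) (n : ℕ) (f : Path E n → ℝ) : ℝ :=
  etaN ξ n f * ∏ p ∈ Finset.Ico 1 n, etaN ξ p (M.G p)

/-- `P_n^N(a) = γ_n^N(T_n^{(a)}(1))`. -/
noncomputable def probN {N n : ℕ} (V : E n → ℝ) (a : ℝ) (ξ : Swarm E N) : ℝ :=
  M.gammaN ξ n (M.weight V a fun _ => 1)

/-- `P_n^N(a, φ) = η_n^N(T_n^{(a)}(φ)) / η_n^N(T_n^{(a)}(1))`, and `0` when the denominator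
vanishes. -/
noncomputable def condMeanN {N n : ℕ} (V : E n → ℝ) (a : ℝ) (φ : Path E n → ℝ)
    (ξ : Swarm E N) : ℝ :=
  etaN ξ n (M.weight V a φ) / etaN ξ n (M.weight V a fun _ => 1)

end Model

end RareEvent

/-! For a bounded functional `F` of the trajectory, let `twist p F` be its conditional expectation
given the first `p` steps, divided by the product of the potentials before `p`. The unnormalized
particle estimates `martingaleN p F` of these functions form a martingale in `p` started at `E[F]`:
the factor `G_p` brought in by selection is exactly what the next twist divides by
(`massN_mul_integral_twist_succ`). At time `n` the potentials cancel against the weight `T_n`. So on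
`P_n^N(a) > 0` the error is a ratio `A / B` of two terminal values, for `(φ - P_n(a, φ)) 1_{V ≥ a}`
and `1_{V ≥ a}`, with means `0` and `P = P_n(a)`.

Expanding `1 / B` to second order around `P` leaves `-P⁻² E[A B]` and a remainder
(`tendsto_mul_integral_ratio`). Given the past, a martingale increment is a bounded factor times the
error of an empirical mean of `N` i.i.d. bounded variables. Fourth central moments are therefore
`O(N⁻²)`, and the remainder is `O(N^{-3/2})`.

The moment `E[A B]` obeys an exact recursion in time (`mixedMoment_succ`): pairs of distinct
particles reproduce the previous moment, and coinciding pairs, of weight `1/N`, add a new one. Since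
`A` is centred, `N E[A B]` tends to the sum of the contributions `γ_p(1) E[crossTwist p]`
(`tendsto_mul_mixedMoment_sub`). Of the two twists and one potential in `crossTwist`, a single
inverse potential survives, whence `γ_p⁻` (`integral_crossTwist`). -/

/-! ### Bounded measurable functions -/

/-- A bounded measurable real function. -/
structure BddMeasurable {Ω : Type*} [MeasurableSpace Ω] (f : Ω → ℝ) : Prop where
  measurable : Measurable f
  bdd : ∃ C, ∀ x, |f x| ≤ C

namespace BddMeasurable

variable {Ω Ω' : Type*} [MeasurableSpace Ω] [MeasurableSpace Ω'] {f g : Ω → ℝ}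

lemma const (c : ℝ) : BddMeasurable fun _ : Ω => c := ⟨measurable_const, |c|, fun _ => le_rfl⟩

lemma mul (hf : BddMeasurable f) (hg : BddMeasurable g) : BddMeasurable fun x => f x * g x := by
  obtain ⟨hf, C, hC⟩ := hf
  obtain ⟨hg, D, hD⟩ := hg
  refine ⟨hf.mul hg, C * D, fun x => ?_⟩
  rw [abs_mul]
  exact mul_le_mul (hC x) (hD x) (abs_nonneg _) ((abs_nonneg _).trans (hC x))

lemma add (hf : BddMeasurable f) (hg : BddMeasurable g) : BddMeasurable fun x => f x + g x := by
  obtain ⟨hf, C, hC⟩ := hf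
  obtain ⟨hg, D, hD⟩ := hg
  exact ⟨hf.add hg, C + D, fun x => (abs_add_le _ _).trans (add_le_add (hC x) (hD x))⟩

lemma neg (hf : BddMeasurable f) : BddMeasurable fun x => -f x := by
  obtain ⟨hf, C, hC⟩ := hf
  exact ⟨hf.neg, C, fun x => by rw [abs_neg]; exact hC x⟩

lemma sub (hf : BddMeasurable f) (hg : BddMeasurable g) : BddMeasurable fun x => f x - g x := by
  simpa only [sub_eq_add_neg] using hf.add hg.neg

lemma pow (hf : BddMeasurable f) (n : ℕ) : BddMeasurable fun x => f x ^ n := by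
  induction n with
  | zero => simpa using const 1
  | succ n ih => simpa only [pow_succ] using ih.mul hf

lemma abs (hf : BddMeasurable f) : BddMeasurable fun x => |f x| := by
  obtain ⟨hf, C, hC⟩ := hf
  exact ⟨hf.abs, C, fun x => by rw [abs_abs]; exact hC x⟩

lemma prod {ι : Type*} (s : Finset ι) {f : ι → Ω → ℝ} (hf : ∀ i ∈ s, BddMeasurable (f i)) :
    BddMeasurable fun x => ∏ i ∈ s, f i x := by
  classical
  induction s using Finset.induction_on with
  | empty => simpa using const 1
  | insert i s hi ih =>
    simp only [Finset.prod_insert hi]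
    exact (hf i (Finset.mem_insert_self i s)).mul
      (ih fun j hj => hf j (Finset.mem_insert_of_mem hj))

lemma comp (hf : BddMeasurable f) {u : Ω' → Ω} (hu : Measurable u) :
    BddMeasurable fun x => f (u x) :=
  ⟨hf.measurable.comp hu, hf.bdd.imp fun _ h x => h (u x)⟩

lemma indicator (hf : BddMeasurable f) {s : Set Ω} (hs : MeasurableSet s) :
    BddMeasurable (s.indicator f) := by
  obtain ⟨hf, C, hC⟩ := hf
  refine ⟨hf.indicator hs, C, fun x => ?_⟩
  by_cases hx : x ∈ s
  · simpa [hx] using hC x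
  · simpa [hx] using (abs_nonneg _).trans (hC x)

lemma integrable (hf : BddMeasurable f) (μ : Measure Ω) [IsFiniteMeasure μ] : Integrable f μ := by
  obtain ⟨hf, C, hC⟩ := hf
  exact .of_bound hf.aestronglyMeasurable C (ae_of_all _ hC)

lemma integral_kernel {f : Ω → Ω' → ℝ} (hf : BddMeasurable (Function.uncurry f))
    (κ : Kernel Ω Ω') [IsMarkovKernel κ] : BddMeasurable fun x => ∫ y, f x y ∂κ x := by
  obtain ⟨hf, C, hC⟩ := hf
  refine ⟨(StronglyMeasurable.integral_kernel_prod_right (f := f)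
    hf.stronglyMeasurable).measurable, C, fun x => ?_⟩
  simpa using norm_integral_le_of_norm_le_const (μ := κ x) (ae_of_all _ fun y =>
    (Real.norm_eq_abs _).trans_le (hC (x, y)))

end BddMeasurable

/-! ### Conditioning trajectories on an initial segment -/

lemma frestrictLe_updateFinset {X : ℕ → Type*} (p : ℕ) (x : (n : ℕ) → X n)
    (y : (i : Finset.Iic p) → X i) :
    Preorder.frestrictLe p (Function.updateFinset x (Finset.Iic p) y) = y := by
  ext i
  simp [Function.updateFinset, Preorder.frestrictLe]

lemma frestrictLe_congr {X : ℕ → Type*} {p k : ℕ} (hk : k ≤ p) {x x' : (n : ℕ) → X n}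
    (h : Preorder.frestrictLe p x = Preorder.frestrictLe p x') : Preorder.frestrictLe k x = Preorder.frestrictLe k x' := by
  ext i
  exact congr_fun h ⟨i, Finset.mem_Iic.2 ((Finset.mem_Iic.1 i.2).trans hk)⟩

section Traj

open Preorder ProbabilityTheory.Kernel

variable {X : ℕ → Type*} [∀ n, MeasurableSpace (X n)]
  {κ : (n : ℕ) → Kernel ((i : Finset.Iic n) → X i) (X (n + 1))} [∀ n, IsMarkovKernel (κ n)]

/-- The integral can be computed after overwriting the first coordinates by `s`, so only extensions
of `s` matter. This avoids an almost-everywhere statement, for which `{s}` might fail to be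
measurable. -/
lemma integral_traj_congr {a : ℕ} {s : (i : Finset.Iic a) → X i} {f g : ((n : ℕ) → X n) → ℝ}
    (hf : Measurable f) (hg : Measurable g) (h : ∀ x, frestrictLe a x = s → f x = g x) :
    ∫ x, f x ∂traj κ a s = ∫ x, g x ∂traj κ a s := by
  rw [integral_traj s hf.aestronglyMeasurable, integral_traj s hg.aestronglyMeasurable]
  congr 1 with x
  exact h _ (frestrictLe_updateFinset a x s)

lemma integral_traj_integral_traj {a p : ℕ} (hap : a ≤ p) (s : (i : Finset.Iic a) → X i)
    {f : ((n : ℕ) → X n) → ℝ} (hf : BddMeasurable f) :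
    ∫ x, ∫ x', f x' ∂traj κ p (frestrictLe p x) ∂traj κ a s = ∫ x, f x ∂traj κ a s := by
  rw [← integral_traj_partialTraj hap (hf.integrable _), ← traj_map_frestrictLe_apply,
    integral_map (by fun_prop)]
  exact (BddMeasurable.integral_kernel (f := fun _ => f) (hf.comp measurable_snd)
    _).measurable.aestronglyMeasurable

/-- Conditioning the trajectory on its first `p` steps. -/
lemma integral_traj_succ {a p : ℕ} (hap : a ≤ p) (s : (i : Finset.Iic a) → X i)
    {h : ((n : ℕ) → X n) → X (p + 1) → ℝ} (hm : BddMeasurable (Function.uncurry h))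
    (hdep : ∀ x x', frestrictLe p x = frestrictLe p x' → h x = h x') :
    ∫ x, h x (x (p + 1)) ∂traj κ a s
      = ∫ x, ∫ z, h x z ∂κ p (frestrictLe p x) ∂traj κ a s := by
  have hm' : BddMeasurable fun x : (n : ℕ) → X n => h x (x (p + 1)) :=
    hm.comp (u := fun x => (x, x (p + 1))) (by fun_prop)
  rw [← integral_traj_integral_traj hap s hm']
  congr 1 with x
  rw [integral_traj _ hm'.measurable.aestronglyMeasurable, ← map_traj_succ_self (κ := κ),
    map_apply _ (by fun_prop), integral_map (measurable_pi_apply (p + 1)).aemeasurable]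
  · congr 1 with x'
    rw [hdep _ x (frestrictLe_updateFinset p x' _)]
    simp [Function.updateFinset]
  · exact (hm.comp (u := fun z => (x, z)) (by fun_prop)).measurable.aestronglyMeasurable

end Traj

/-! ### Moments of empirical means of i.i.d. samples -/

section Sampling

variable {F : Type*} [MeasurableSpace F]

open RareEvent.Model in
lemma integral_empirical {N : ℕ} (ξ : Fin N → F) {f : F → ℝ} (hf : Measurable f) :
    ∫ y, f y ∂(empirical ξ) = (N : ℝ)⁻¹ * ∑ i, f (ξ i) := by
  rw [empirical, integral_smul_measure, integral_finsetSum_measure]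
  · simp [integral_dirac' _ _ hf.stronglyMeasurable]
  · intro i _
    exact integrable_dirac' hf.stronglyMeasurable (by simp)

variable {μ : Measure F} [IsProbabilityMeasure μ] {N : ℕ} {f g : F → ℝ}

lemma integral_pi_eval (hf : Measurable f) (i : Fin N) :
    ∫ z, f (z i) ∂(Measure.pi fun _ : Fin N => μ) = ∫ y, f y ∂μ := by
  have h := measurePreserving_eval (fun _ : Fin N => μ) i
  rw [← h.map_eq, integral_map (measurable_pi_apply i).aemeasurable hf.aestronglyMeasurable, h.map_eq]

lemma integral_pi_eval_mul_eval (hf : Measurable f) (hg : Measurable g) {i j : Fin N}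
    (hij : i ≠ j) :
    ∫ z, f (z i) * g (z j) ∂(Measure.pi fun _ : Fin N => μ) = (∫ y, f y ∂μ) * ∫ y, g y ∂μ := by
  have h := (iIndepFun_pi (μ := fun _ : Fin N => μ) (X := fun _ y => y)
    (fun _ => aemeasurable_id')).indepFun hij
  have h' := (h.comp hf hg).integral_fun_mul_eq_mul_integral
    (hf.comp (measurable_pi_apply i)).aestronglyMeasurable
    (hg.comp (measurable_pi_apply j)).aestronglyMeasurable
  simp only [Function.comp_def] at h'
  rw [h', integral_pi_eval hf, integral_pi_eval hg]

lemma integral_mean (hN : N ≠ 0) (hf : BddMeasurable f) :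
    ∫ z, (N : ℝ)⁻¹ * ∑ i, f (z i) ∂(Measure.pi fun _ : Fin N => μ) = ∫ y, f y ∂μ := by
  rw [integral_const_mul, integral_finsetSum _ fun i _ =>
    (hf.comp (measurable_pi_apply i)).integrable _]
  simp only [integral_pi_eval hf.measurable]
  simp [hN]

/-- Of the `N²` pairs of indices, the `N` diagonal ones give the integral of `f g`; the others
factor by independence. -/
lemma integral_mean_mul_mean (hN : N ≠ 0) (hf : BddMeasurable f) (hg : BddMeasurable g) :
    ∫ z, ((N : ℝ)⁻¹ * ∑ i, f (z i)) * ((N : ℝ)⁻¹ * ∑ i, g (z i))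
        ∂(Measure.pi fun _ : Fin N => μ)
      = (N : ℝ)⁻¹ * ∫ y, f y * g y ∂μ
        + (1 - (N : ℝ)⁻¹) * ((∫ y, f y ∂μ) * ∫ y, g y ∂μ) := by
  have hN' : (N : ℝ) ≠ 0 := by exact_mod_cast hN
  have hfi : ∀ i : Fin N, BddMeasurable fun z : Fin N → F => f (z i) :=
    fun i => hf.comp (measurable_pi_apply i)
  have hgi : ∀ i : Fin N, BddMeasurable fun z : Fin N → F => g (z i) :=
    fun i => hg.comp (measurable_pi_apply i)
  have key : ∀ i j : Fin N, ∫ z, f (z i) * g (z j) ∂(Measure.pi fun _ : Fin N => μ)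
      = (∫ y, f y ∂μ) * (∫ y, g y ∂μ)
        + if i = j then (∫ y, f y * g y ∂μ) - (∫ y, f y ∂μ) * ∫ y, g y ∂μ else 0 := by
    intro i j
    split_ifs with h
    · subst h
      rw [integral_pi_eval (f := fun y => f y * g y) (hf.mul hg).measurable i]
      ring
    · rw [integral_pi_eval_mul_eval hf.measurable hg.measurable h, add_zero]
  have : ∀ z : Fin N → F, ((N : ℝ)⁻¹ * ∑ i, f (z i)) * ((N : ℝ)⁻¹ * ∑ i, g (z i))
      = (N : ℝ)⁻¹ ^ 2 * ∑ i, ∑ j, f (z i) * g (z j) := by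
    intro z
    rw [← Finset.sum_mul_sum]
    ring
  simp only [this]
  rw [integral_const_mul, integral_finsetSum _ fun i _ =>
    integrable_finsetSum _ fun j _ => ((hfi i).mul (hgi j)).integrable _]
  simp only [integral_finsetSum _ fun j _ => ((hfi _).mul (hgi j)).integrable _, key,
    Finset.sum_add_distrib, Finset.sum_ite_eq]
  simp
  field_simp
  ring

lemma pow_four_le_exp_add_exp (x : ℝ) : x ^ 4 ≤ 24 * (Real.exp x + Real.exp (-x)) := by
  have h := Real.pow_div_factorial_le_exp (x := |x|) (abs_nonneg x) 4
  have h4 : |x| ^ 4 = x ^ 4 := by rw [pow_abs, abs_of_nonneg (by positivity)]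
  have h2 : Real.exp |x| ≤ Real.exp x + Real.exp (-x) := by
    rcases abs_choice x with h | h <;> rw [h] <;>
      linarith [Real.exp_pos x, Real.exp_pos (-x)]
  rw [h4, div_le_iff₀ (by positivity)] at h
  norm_num [Nat.factorial] at h
  linarith

/-- Dominate `(t X)⁴` by exponentials and use the bound on the moment generating function at `t` and
`-t`. -/
lemma ProbabilityTheory.HasSubgaussianMGF.integral_pow_four_le {Ω : Type*} [MeasurableSpace Ω]
    {μ : Measure Ω} {X : Ω → ℝ} {c : NNReal} (hc : 0 < c) (h : HasSubgaussianMGF X c μ) :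
    ∫ ω, X ω ^ 4 ∂μ ≤ 48 * Real.exp (1 / 2) * c ^ 2 := by
  have hc' : (0 : ℝ) < c := by exact_mod_cast hc
  have hs : (√(c : ℝ)) ^ 2 = c := Real.sq_sqrt hc'.le
  have hs0 : 0 < √(c : ℝ) := Real.sqrt_pos.2 hc'
  -- With this scale the exponent `c t² / 2` is the constant `1 / 2`, and `t⁻⁴ = c²`.
  set t : ℝ := (√(c : ℝ))⁻¹ with ht
  have ht2 : c * t ^ 2 / 2 = 1 / 2 := by rw [ht, inv_pow, hs]; field_simp
  have ht4 : t ^ 4 = ((c : ℝ) ^ 2)⁻¹ := by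
    rw [ht, inv_pow, show 4 = 2 * 2 from rfl, pow_mul, hs]
  have h1 := h.mgf_le t
  have h2 := h.mgf_le (-t)
  rw [neg_sq] at h2
  rw [ht2] at h1 h2
  simp only [mgf] at h1 h2
  have hle : ∫ ω, (t * X ω) ^ 4 ∂μ ≤ ∫ ω, 24 * (Real.exp (t * X ω) + Real.exp (-t * X ω)) ∂μ := by
    refine integral_mono_of_nonneg (ae_of_all _ fun ω => by positivity)
      (((h.integrable_exp_mul t).add (h.integrable_exp_mul (-t))).const_mul 24)
      (ae_of_all _ fun ω => ?_)
    simpa only [neg_mul] using pow_four_le_exp_add_exp (t * X ω)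
  rw [integral_const_mul, integral_add (h.integrable_exp_mul t) (h.integrable_exp_mul (-t))] at hle
  simp only [mul_pow] at hle
  rw [integral_const_mul, ht4, inv_mul_le_iff₀ (by positivity)] at hle
  nlinarith [sq_nonneg (c : ℝ)]

/-- By Hoeffding's lemma each centred term is sub-Gaussian with constant `C²`. Independence gives `N
C²` for the sum, and dividing by `N⁴` leaves the order `N⁻²`. -/
lemma integral_mean_sub_pow_four_le (hN : N ≠ 0) {C : ℝ} (hC0 : 0 < C) (hf : Measurable f)
    (hC : ∀ y, |f y| ≤ C) :
    ∫ z, ((N : ℝ)⁻¹ * ∑ i, f (z i) - ∫ y, f y ∂μ) ^ 4 ∂(Measure.pi fun _ : Fin N => μ)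
      ≤ 48 * Real.exp (1 / 2) * C ^ 4 * (N : ℝ)⁻¹ ^ 2 := by
  have hN' : (0 : ℝ) < N := by exact_mod_cast Nat.pos_of_ne_zero hN
  set m := ∫ y, f y ∂μ with hm
  have hsub : ∀ i : Fin N, HasSubgaussianMGF (fun z : Fin N → F => f (z i) - m)
      ((‖C - (-C)‖₊ / 2) ^ 2) (Measure.pi fun _ : Fin N => μ) := by
    intro i
    have := hasSubgaussianMGF_of_mem_Icc (μ := Measure.pi fun _ : Fin N => μ)
      (X := fun z : Fin N → F => f (z i)) (hf.comp (measurable_pi_apply i)).aemeasurable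
      (ae_of_all _ fun z => abs_le.1 (hC (z i)))
    rwa [integral_pi_eval hf] at this
  have hind : iIndepFun (fun (i : Fin N) (z : Fin N → F) => f (z i) - m)
      (Measure.pi fun _ : Fin N => μ) :=
    iIndepFun_pi (μ := fun _ : Fin N => μ) (X := fun _ y => f y - m)
      fun _ => (hf.sub_const m).aemeasurable
  have hS := HasSubgaussianMGF.sum_of_iIndepFun hind (s := Finset.univ) fun i _ => hsub i
  have hCC : (‖C - (-C)‖₊ : ℝ) / 2 = C := by
    rw [coe_nnnorm, Real.norm_eq_abs, abs_of_pos (by linarith)]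
    ring
  have hc : ((∑ _i : Fin N, (‖C - (-C)‖₊ / 2) ^ 2 : NNReal) : ℝ) = N * C ^ 2 := by
    push_cast
    rw [Finset.sum_const, Finset.card_univ, Fintype.card_fin, nsmul_eq_mul, ← coe_nnnorm, hCC]
  have h4 := hS.integral_pow_four_le (by
    rw [← NNReal.coe_pos, hc]
    positivity)
  rw [hc] at h4
  have : ∀ z : Fin N → F, ((N : ℝ)⁻¹ * ∑ i, f (z i) - m) ^ 4
      = (N : ℝ)⁻¹ ^ 4 * (∑ i, (f (z i) - m)) ^ 4 := by
    intro z
    rw [← mul_pow, Finset.sum_sub_distrib, mul_sub]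
    simp [hN]
  simp only [this]
  rw [integral_const_mul]
  calc _ ≤ (N : ℝ)⁻¹ ^ 4 * (48 * Real.exp (1 / 2) * (N * C ^ 2) ^ 2) := by gcongr
    _ = _ := by field_simp

end Sampling

/-! ### Bias of a ratio of concentrated variables -/

section Ratio

variable {Ω : ℕ → Type*} [∀ N, MeasurableSpace (Ω N)] {μ : ∀ N, Measure (Ω N)}
  [∀ N, IsProbabilityMeasure (μ N)]

/-- The second-order remainder in the expansion of a ratio is controlled by fourth moments. -/
lemma abs_ratio_mul_sq_le {A B C P s : ℝ} (hP : 0 < P) (hs : 0 < s) (hC : 0 ≤ C) (hB : 0 ≤ B)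
    (hAB : |A| ≤ C * B) :
    |A / B * (B - P) ^ 2| ≤ P⁻¹ * (s ^ 3 / 2 + s⁻¹ / 2 * A ^ 4 + s⁻¹ * (B - P) ^ 4)
      + 4 * C / P ^ 2 * (B - P) ^ 4 := by
  have h4 : 0 ≤ (B - P) ^ 4 := by positivity
  have hA4 : 0 ≤ A ^ 4 := by positivity
  have hs' : 0 < s⁻¹ := inv_pos.2 hs
  rw [abs_mul, abs_of_nonneg (sq_nonneg (B - P)), abs_div, abs_of_nonneg hB]
  rcases le_or_gt (P / 2) B with h | h
  · have hB0 : 0 < B := by linarith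
    have h1 : |A| / B ≤ 2 * P⁻¹ * |A| := by
      rw [div_le_iff₀ hB0]
      have : 1 ≤ 2 * P⁻¹ * B := by
        rw [mul_assoc, inv_mul_eq_div, ← div_le_iff₀' two_pos, le_div_iff₀ hP]
        linarith
      nlinarith [abs_nonneg A]
    -- Two uses of Young's inequality with weight `s` reduce the product to fourth powers and `s³`.
    -- For `s = N^{-1/2}` and fourth moments of order `s⁴`, every term has order `s³`.
    have h2 : |A| * (B - P) ^ 2 ≤ (s * A ^ 2 + s⁻¹ * (B - P) ^ 4) / 2 := by
      have : 0 ≤ s⁻¹ * (s * |A| - (B - P) ^ 2) ^ 2 := by positivity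
      have e : s⁻¹ * (s * |A| - (B - P) ^ 2) ^ 2
          = s * |A| ^ 2 + s⁻¹ * (B - P) ^ 4 - 2 * (|A| * (B - P) ^ 2) := by
        field_simp
        ring
      rw [e, sq_abs] at this
      linarith
    have h3 : s * A ^ 2 ≤ (s ^ 3 + s⁻¹ * A ^ 4) / 2 := by
      have : 0 ≤ s⁻¹ * (A ^ 2 - s ^ 2) ^ 2 := by positivity
      have e : s⁻¹ * (A ^ 2 - s ^ 2) ^ 2 = s⁻¹ * A ^ 4 + s ^ 3 - 2 * (s * A ^ 2) := by
        field_simp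
        ring
      rw [e] at this
      linarith
    calc |A| / B * (B - P) ^ 2 ≤ 2 * P⁻¹ * |A| * (B - P) ^ 2 := by gcongr
      _ = P⁻¹ * (2 * (|A| * (B - P) ^ 2)) := by ring
      _ ≤ P⁻¹ * (s ^ 3 / 2 + s⁻¹ / 2 * A ^ 4 + s⁻¹ * (B - P) ^ 4) := by
        gcongr
        linarith
      _ ≤ _ := le_add_of_nonneg_right (by positivity)
  -- Here `B` may be close to `0`, but the ratio is bounded and `|B - P| ≥ P / 2`, so two extra
  -- powers of `B - P` cost only `4 / P²`.
  · have h1 : |A| / B ≤ C := div_le_of_le_mul₀ hB hC hAB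
    have h2 : (B - P) ^ 2 ≤ 4 / P ^ 2 * (B - P) ^ 4 := by
      have : P ^ 2 / 4 ≤ (B - P) ^ 2 := by nlinarith
      rw [div_mul_eq_mul_div, le_div_iff₀ (by positivity)]
      nlinarith [sq_nonneg (B - P)]
    calc |A| / B * (B - P) ^ 2 ≤ C * (4 / P ^ 2 * (B - P) ^ 4) := by gcongr
      _ = 4 * C / P ^ 2 * (B - P) ^ 4 := by ring
      _ ≤ _ := le_add_of_nonneg_left (by positivity)

/-- The bias of a ratio of two random variables with Gaussian-type concentration. -/
lemma tendsto_mul_integral_ratio {A B : ∀ N, Ω N → ℝ} (hA : ∀ N, BddMeasurable (A N))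
    (hB : ∀ N, BddMeasurable (B N)) {C P K L : ℝ} (hC : 0 ≤ C) (hP : 0 < P)
    (hB0 : ∀ N ω, 0 ≤ B N ω) (hAB : ∀ N ω, |A N ω| ≤ C * B N ω)
    (hA0 : ∀ᶠ N in atTop, ∫ ω, A N ω ∂μ N = 0)
    (hA4 : ∀ᶠ N : ℕ in atTop, ∫ ω, A N ω ^ 4 ∂μ N ≤ K * (N : ℝ)⁻¹ ^ 2)
    (hB4 : ∀ᶠ N : ℕ in atTop, ∫ ω, (B N ω - P) ^ 4 ∂μ N ≤ K * (N : ℝ)⁻¹ ^ 2)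
    (hL : Tendsto (fun N : ℕ => (N : ℝ) * ∫ ω, A N ω * B N ω ∂μ N) atTop (𝓝 L)) :
    Tendsto (fun N : ℕ => (N : ℝ) * ∫ ω, A N ω / B N ω ∂μ N) atTop (𝓝 (-(P ^ 2)⁻¹ * L)) := by
  have hR : ∀ N, BddMeasurable fun ω => A N ω / B N ω * (B N ω - P) ^ 2 := fun N =>
    BddMeasurable.mul ⟨(hA N).measurable.div (hB N).measurable, C, fun ω => by
      rw [abs_div, abs_of_nonneg (hB0 N ω)]
      exact div_le_of_le_mul₀ (hB0 N ω) hC (hAB N ω)⟩ (((hB N).sub (.const P)).pow 2)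
  have hdec : ∀ᶠ N : ℕ in atTop, (N : ℝ) * ∫ ω, A N ω / B N ω ∂μ N
      = -(P ^ 2)⁻¹ * ((N : ℝ) * ∫ ω, A N ω * B N ω ∂μ N)
        + (P ^ 2)⁻¹ * ((N : ℝ) * ∫ ω, A N ω / B N ω * (B N ω - P) ^ 2 ∂μ N) := by
    filter_upwards [hA0] with N hN
    -- Exact second-order expansion of `1 / B` at `P`. At `B = 0` it survives because the domination
    -- forces `A = 0`.
    have e : ∀ ω, A N ω / B N ω = 2 / P * A N ω - (P ^ 2)⁻¹ * (A N ω * B N ω)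
        + (P ^ 2)⁻¹ * (A N ω / B N ω * (B N ω - P) ^ 2) := by
      intro ω
      rcases eq_or_ne (B N ω) 0 with h | h
      · have : A N ω = 0 := by simpa [h] using hAB N ω
        simp [this]
      · field_simp
        ring
    have hi1 := ((hA N).integrable (μ N)).const_mul (2 / P)
    have hi2 := (((hA N).mul (hB N)).integrable (μ N)).const_mul (P ^ 2)⁻¹
    have hi3 := ((hR N).integrable (μ N)).const_mul (P ^ 2)⁻¹
    have hi12 : Integrable (fun ω => 2 / P * A N ω - (P ^ 2)⁻¹ * (A N ω * B N ω)) (μ N) :=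
      hi1.sub hi2
    rw [integral_congr_ae (ae_of_all _ e), integral_add hi12 hi3, integral_sub hi1 hi2,
      integral_const_mul, integral_const_mul, integral_const_mul, hN]
    ring
  have hrem : Tendsto (fun N : ℕ => (N : ℝ) * ∫ ω, A N ω / B N ω * (B N ω - P) ^ 2 ∂μ N) atTop
      (𝓝 0) := by
    have hs : Tendsto (fun N : ℕ => (√(N : ℝ))⁻¹) atTop (𝓝 0) :=
      (Real.tendsto_sqrt_atTop.comp tendsto_natCast_atTop_atTop).inv_tendsto_atTop
    have hlim : Tendsto (fun N : ℕ => P⁻¹ * (1 / 2 + 3 / 2 * K) * (√(N : ℝ))⁻¹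
        + 4 * C / P ^ 2 * K * (√(N : ℝ))⁻¹ ^ 2) atTop (𝓝 0) := by
      simpa using (hs.const_mul (P⁻¹ * (1 / 2 + 3 / 2 * K))).add
        ((hs.pow 2).const_mul (4 * C / P ^ 2 * K))
    refine squeeze_zero_norm' ?_ hlim
    filter_upwards [hA4, hB4, eventually_gt_atTop 0] with N h1 h2 hN
    have hN' : (0 : ℝ) < N := by exact_mod_cast hN
    have hsq : (√(N : ℝ))⁻¹ ^ 2 = (N : ℝ)⁻¹ := by rw [inv_pow, Real.sq_sqrt hN'.le]
    have hs0 : 0 < (√(N : ℝ))⁻¹ := inv_pos.2 (Real.sqrt_pos.2 hN')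
    set s := (√(N : ℝ))⁻¹
    have hNs : (N : ℝ) = (s ^ 2)⁻¹ := by rw [hsq, inv_inv]
    rw [← hsq] at h1 h2
    have iA := ((hA N).pow 4).integrable (μ N)
    have iB := (((hB N).sub (.const P)).pow 4).integrable (μ N)
    have hint : ∫ ω, |A N ω / B N ω * (B N ω - P) ^ 2| ∂μ N
        ≤ P⁻¹ * (s ^ 3 / 2 + s⁻¹ / 2 * ∫ ω, A N ω ^ 4 ∂μ N + s⁻¹ * ∫ ω, (B N ω - P) ^ 4 ∂μ N)
          + 4 * C / P ^ 2 * ∫ ω, (B N ω - P) ^ 4 ∂μ N := by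
      have j1 : Integrable (fun ω => s ^ 3 / 2 + s⁻¹ / 2 * A N ω ^ 4) (μ N) :=
        (integrable_const _).add (iA.const_mul _)
      have j2 : Integrable (fun ω => P⁻¹ * (s ^ 3 / 2 + s⁻¹ / 2 * A N ω ^ 4
          + s⁻¹ * (B N ω - P) ^ 4)) (μ N) := (j1.add (iB.const_mul _)).const_mul _
      have j3 := iB.const_mul (4 * C / P ^ 2)
      calc _ ≤ ∫ ω, (P⁻¹ * (s ^ 3 / 2 + s⁻¹ / 2 * A N ω ^ 4 + s⁻¹ * (B N ω - P) ^ 4)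
              + 4 * C / P ^ 2 * (B N ω - P) ^ 4) ∂μ N :=
            integral_mono ((hR N).abs.integrable _) (j2.add j3) fun ω =>
              abs_ratio_mul_sq_le hP hs0 hC (hB0 N ω) (hAB N ω)
        _ = _ := by
          rw [integral_add j2 j3, integral_const_mul, integral_const_mul,
            integral_add j1 (iB.const_mul s⁻¹), integral_const_mul,
            integral_add (integrable_const _) (iA.const_mul _), integral_const_mul]
          simp
    rw [norm_mul, Real.norm_of_nonneg hN'.le]
    calc (N : ℝ) * ‖∫ ω, A N ω / B N ω * (B N ω - P) ^ 2 ∂μ N‖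
        ≤ (N : ℝ) * ∫ ω, |A N ω / B N ω * (B N ω - P) ^ 2| ∂μ N := by
          gcongr
          exact norm_integral_le_integral_norm _
      _ ≤ N * (P⁻¹ * (s ^ 3 / 2 + s⁻¹ / 2 * (K * (s ^ 2) ^ 2) + s⁻¹ * (K * (s ^ 2) ^ 2))
          + 4 * C / P ^ 2 * (K * (s ^ 2) ^ 2)) := by
          gcongr
          exact hint.trans (by gcongr)
      _ = _ := by
          rw [hNs]
          field_simp
          ring
  refine Tendsto.congr' (hdec.mono fun _ h => h.symm) ?_
  simpa using (hL.const_mul (-(P ^ 2)⁻¹)).add (hrem.const_mul (P ^ 2)⁻¹)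

end Ratio

/-! ### Potentials, twists and the one-step particle evolution -/

namespace RareEvent

namespace Model

open Preorder

variable {E : ℕ → Type*} [∀ n, MeasurableSpace (E n)] (M : Model E)

instance (p : ℕ) (y : Path E p) : IsProbabilityMeasure (M.lawGiven p y) := by
  unfold lawGiven
  infer_instance

instance : IsProbabilityMeasure M.law := by
  unfold law
  infer_instance

instance (N : ℕ) : IsProbabilityMeasure (M.particleLaw N) := by
  unfold particleLaw
  infer_instance

/-- The ratio bound against one fixed path bounds `G p` above. Applied to `M.inv`, the same lemma
bounds the inverse potentials. -/
lemma bddMeasurable_G (p : ℕ) : BddMeasurable (M.G p) := by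
  refine ⟨M.measurable_G p, ?_⟩
  obtain ⟨C, hC⟩ := M.G_ratio p
  rcases isEmpty_or_nonempty (Path E p) with h | ⟨⟨y⟩⟩
  · exact ⟨0, fun y => h.elim y⟩
  · refine ⟨C * M.G p y, fun y' => ?_⟩
    rw [abs_of_pos (M.G_pos p y'), ← div_le_iff₀ (M.G_pos p y)]
    exact hC y' y

/-- The product `∏_{1 ≤ k < p} G_k(x_0, ..., x_k)` along a trajectory. -/
noncomputable def potential (p : ℕ) (x : (n : ℕ) → E n) : ℝ :=
  ∏ k ∈ Finset.Ico 1 p, M.G k (frestrictLe k x)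

lemma potential_pos (p : ℕ) (x : (n : ℕ) → E n) : 0 < M.potential p x :=
  Finset.prod_pos fun _ _ => M.G_pos _ _

lemma bddMeasurable_potential (p : ℕ) : BddMeasurable (M.potential p) :=
  BddMeasurable.prod _ fun k _ => (M.bddMeasurable_G k).comp (measurable_frestrictLe k)

lemma inv_potential (p : ℕ) (x : (n : ℕ) → E n) :
    M.inv.potential p x = (M.potential p x)⁻¹ :=
  Finset.prod_inv_distrib _

lemma bddMeasurable_potential_inv (p : ℕ) : BddMeasurable fun x => (M.potential p x)⁻¹ := by
  have := M.inv.bddMeasurable_potential p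
  rwa [funext (M.inv_potential p)] at this

lemma potential_congr {p q : ℕ} (hq : q ≤ p + 1) {x x' : (n : ℕ) → E n}
    (h : frestrictLe p x = frestrictLe p x') : M.potential q x = M.potential q x' := by
  refine Finset.prod_congr rfl fun k hk => ?_
  rw [frestrictLe_congr (by have := Finset.mem_Ico.1 hk; omega) h]

lemma exists_frestrictLe_eq (M : Model E) {p : ℕ} (y : Path E p) : ∃ x : (n : ℕ) → E n, frestrictLe p x = y := by
  obtain ⟨x⟩ := nonempty_of_isProbabilityMeasure (M.lawGiven p y)
  exact ⟨_, frestrictLe_updateFinset p x y⟩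

/-- Taking out what is known at time `p`, valid for every path rather than almost every one. -/
lemma integral_lawGiven_mul {p : ℕ} {c F : ((n : ℕ) → E n) → ℝ} (hc : Measurable c)
    (hF : Measurable F) (hdep : ∀ x x', frestrictLe p x = frestrictLe p x' → c x = c x')
    (x : (n : ℕ) → E n) :
    ∫ x', c x' * F x' ∂M.lawGiven p (frestrictLe p x)
      = c x * ∫ x', F x' ∂M.lawGiven p (frestrictLe p x) := by
  rw [← integral_const_mul]
  refine integral_traj_congr (hc.mul hF) (hF.const_mul _) fun x' hx' => ?_
  rw [hdep x' x hx']

/-- The conditional expectation of `F` given `(X_0, ..., X_p) = y`, divided by the product of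
the potentials before time `p`. -/
noncomputable def twist (p : ℕ) (F : ((n : ℕ) → E n) → ℝ) (y : Path E p) : ℝ :=
  ∫ x, F x * (M.potential p x)⁻¹ ∂M.lawGiven p y

variable {M} {F F' : ((n : ℕ) → E n) → ℝ}

lemma bddMeasurable_twist (p : ℕ) (hF : BddMeasurable F) : BddMeasurable (M.twist p F) := by
  have h : BddMeasurable (Function.uncurry fun (_ : Path E p) (x : (n : ℕ) → E n) =>
      F x * (M.potential p x)⁻¹) :=
    (hF.mul (M.bddMeasurable_potential_inv p)).comp measurable_snd
  exact h.integral_kernel (Kernel.traj M.stepKernel p)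

lemma twist_frestrictLe (p : ℕ) (hF : BddMeasurable F) (x : (n : ℕ) → E n) :
    M.twist p F (frestrictLe p x)
      = (M.potential p x)⁻¹ * ∫ x', F x' ∂M.lawGiven p (frestrictLe p x) := by
  rw [← M.integral_lawGiven_mul (M.bddMeasurable_potential_inv p).measurable hF.measurable
    fun x x' h => by rw [M.potential_congr (Nat.le_succ p) h]]
  simp only [twist, mul_comm]

lemma twist_mul_potential {p : ℕ} {f : Path E p → ℝ} (hf : BddMeasurable f) (y : Path E p) :
    M.twist p (fun x => f (frestrictLe p x) * M.potential p x) y = f y := by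
  obtain ⟨x, rfl⟩ := M.exists_frestrictLe_eq y
  have := M.integral_lawGiven_mul (p := p) (c := fun x => f (frestrictLe p x)) (F := fun _ => 1)
    (hf.comp (measurable_frestrictLe p)).measurable measurable_const
    (fun x x' h => by simp only [h]) x
  simp only [twist, mul_assoc, mul_inv_cancel₀ (M.potential_pos p _).ne', this]
  simp

lemma integral_twist_succ (p : ℕ) (hF : BddMeasurable F) (y : Path E p) :
    ∫ z, M.twist (p + 1) F z ∂M.pathKernel p y
      = ∫ x, F x * (M.potential (p + 1) x)⁻¹ ∂M.lawGiven p y :=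
  Kernel.integral_traj_partialTraj p.le_succ
    ((hF.mul (M.bddMeasurable_potential_inv (p + 1))).integrable (M.lawGiven p y))

/-- The products start at `k = 1`, so both potentials are empty and no factor `G 0` enters. -/
lemma integral_twist_one (hF : BddMeasurable F) (y : Path E 0) :
    ∫ z, M.twist 1 F z ∂M.pathKernel 0 y = M.twist 0 F y := by
  rw [integral_twist_succ 0 hF]
  simp [twist, potential]

lemma G_mul_integral_twist_succ {p : ℕ} (hp : 1 ≤ p) (hF : BddMeasurable F) (y : Path E p) :
    M.G p y * ∫ z, M.twist (p + 1) F z ∂M.pathKernel p y = M.twist p F y := by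
  obtain ⟨x, rfl⟩ := M.exists_frestrictLe_eq y
  rw [integral_twist_succ p hF, ← M.integral_lawGiven_mul (c := fun x => M.G p (frestrictLe p x))
    ((M.bddMeasurable_G p).comp (measurable_frestrictLe p)).measurable
    (hF.mul (M.bddMeasurable_potential_inv (p + 1))).measurable fun x x' h => by simp only [h]]
  refine integral_congr_ae (ae_of_all _ fun x => ?_)
  have h1 := (M.potential_pos p x).ne'
  have h2 := (M.G_pos p (frestrictLe p x)).ne'
  have h3 : M.potential (p + 1) x = M.potential p x * M.G p (frestrictLe p x) :=
    Finset.prod_Ico_succ_top hp _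
  simp only [h3]
  field_simp

/-- On an empirical measure, selection and mutation give a finite mixture of the transitions from
the particles, with weights proportional to `G p`. -/
lemma integral_Phi_empirical (p : ℕ) {N : ℕ} (hN : N ≠ 0) (ξ : Fin N → Path E p)
    {g : Path E (p + 1) → ℝ} (hg : BddMeasurable g) :
    ∫ z, g z ∂M.Phi p (empirical ξ)
      = (∑ i, M.G p (ξ i))⁻¹ * ∑ i, M.G p (ξ i) * ∫ z, g z ∂M.pathKernel p (ξ i) := by
  have hS : 0 < ∑ i, M.G p (ξ i) :=
    Finset.sum_pos (fun i _ => M.G_pos p _) ⟨⟨0, Nat.pos_of_ne_zero hN⟩, Finset.mem_univ _⟩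
  have hPhi : M.Phi p (empirical ξ) = ∑ i, ENNReal.ofReal (M.G p (ξ i) / ∑ j, M.G p (ξ j)) •
      M.pathKernel p (ξ i) := by
    ext s hs
    have hG := (M.measurable_G p).ennreal_ofReal
    rw [M.Phi_apply p _ hs, lintegral_empirical _ hG,
      lintegral_empirical _ (show Measurable fun y => ENNReal.ofReal (M.G p y) * M.pathKernel p y s from
        hG.mul ((M.pathKernel p).measurable_coe hs)),
      ← ENNReal.ofReal_sum_of_nonneg fun i _ => (M.G_pos p (ξ i)).le,
      ENNReal.mul_inv (by simp) (by simp [hN]), inv_inv, mul_assoc,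
      mul_left_comm _ (N : ENNReal)⁻¹, ← mul_assoc, ENNReal.mul_inv_cancel (by simpa) (by simp),
      one_mul, Finset.mul_sum]
    simp only [Measure.finsetSum_apply, Measure.smul_apply, smul_eq_mul]
    refine Finset.sum_congr rfl fun i _ => ?_
    rw [ENNReal.ofReal_div_of_pos hS, ENNReal.div_eq_inv_mul, mul_assoc]
  rw [hPhi, integral_finsetSum_measure fun i _ =>
    (hg.integrable (M.pathKernel p (ξ i))).smul_measure ENNReal.ofReal_ne_top, Finset.mul_sum]
  refine Finset.sum_congr rfl fun i _ => ?_
  rw [integral_smul_measure, ENNReal.toReal_ofReal (div_nonneg (M.G_pos p _).le hS.le),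
    smul_eq_mul, div_eq_inv_mul, mul_assoc]

/-! ### The unnormalized particle measures -/

lemma etaN_eq {N : ℕ} (ξ : Swarm E N) (p : ℕ) {f : Path E p → ℝ} (hf : Measurable f) :
    etaN ξ p f = (N : ℝ)⁻¹ * ∑ i, f (ξ p i) :=
  integral_empirical (ξ p) hf

lemma abs_mean_le {F : Type*} {N : ℕ} (ξ : Fin N → F) {f : F → ℝ} {C : ℝ} (hC0 : 0 ≤ C)
    (hC : ∀ y, |f y| ≤ C) : |(N : ℝ)⁻¹ * ∑ i, f (ξ i)| ≤ C := by
  rcases eq_or_ne N 0 with rfl | hN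
  · simpa using hC0
  have hN' : (0 : ℝ) < N := by exact_mod_cast Nat.pos_of_ne_zero hN
  rw [abs_mul, abs_of_pos (inv_pos.2 hN'), inv_mul_le_iff₀ hN']
  calc |∑ i, f (ξ i)| ≤ ∑ i, |f (ξ i)| := Finset.abs_sum_le_sum_abs _ _
    _ ≤ ∑ _i : Fin N, C := Finset.sum_le_sum fun i _ => hC _
    _ = N * C := by simp

lemma bddMeasurable_mean {F : Type*} [MeasurableSpace F] {f : F → ℝ} (hf : BddMeasurable f)
    (N : ℕ) : BddMeasurable fun ξ : Fin N → F => (N : ℝ)⁻¹ * ∑ i, f (ξ i) := by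
  obtain ⟨hf, C, hC⟩ := hf
  refine ⟨(Finset.measurable_sum _ fun i _ => hf.comp (measurable_pi_apply i)).const_mul _,
    |C|, fun ξ => abs_mean_le ξ (abs_nonneg C) fun y => (hC y).trans (le_abs_self C)⟩

lemma bddMeasurable_etaN {N p : ℕ} {f : Path E p → ℝ} (hf : BddMeasurable f) :
    BddMeasurable fun ξ : Swarm E N => etaN ξ p f := by
  simp only [etaN_eq _ _ hf.measurable]
  exact (bddMeasurable_mean hf N).comp (measurable_pi_apply p)

variable (M) in
/-- The product `∏_{1 ≤ k < p} η_k^N(G_k)`. -/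
noncomputable def massN {N : ℕ} (p : ℕ) (ξ : Swarm E N) : ℝ :=
  ∏ k ∈ Finset.Ico 1 p, etaN ξ k (M.G k)

lemma gammaN_eq {N : ℕ} (p : ℕ) (ξ : Swarm E N) (f : Path E p → ℝ) :
    M.gammaN ξ p f = etaN ξ p f * M.massN p ξ := rfl

variable (M) in
lemma bddMeasurable_massN (N p : ℕ) : BddMeasurable (M.massN p : Swarm E N → ℝ) :=
  BddMeasurable.prod _ fun k _ => bddMeasurable_etaN (M.bddMeasurable_G k)

lemma bddMeasurable_gammaN {N p : ℕ} {f : Path E p → ℝ} (hf : BddMeasurable f) :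
    BddMeasurable fun ξ : Swarm E N => M.gammaN ξ p f :=
  (bddMeasurable_etaN hf).mul (M.bddMeasurable_massN N p)

variable (M) in
lemma exists_abs_massN_le (p : ℕ) : ∃ C, ∀ (N : ℕ) (ξ : Swarm E N), |M.massN p ξ| ≤ C := by
  choose C hC using fun k => (M.bddMeasurable_G k).bdd
  refine ⟨∏ k ∈ Finset.Ico 1 p, |C k|, fun N ξ => ?_⟩
  rw [massN, Finset.abs_prod]
  refine Finset.prod_le_prod (fun _ _ => abs_nonneg _) fun k _ => ?_
  rw [etaN_eq _ _ (M.measurable_G k)]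
  exact abs_mean_le _ (abs_nonneg _) fun y => (hC k y).trans (le_abs_self _)

lemma etaN_congr {N p k : ℕ} (hk : k ≤ p) {ξ ξ' : Swarm E N}
    (h : frestrictLe (π := fun n => Fin N → Path E n) p ξ = frestrictLe p ξ')
    (f : Path E k → ℝ) : etaN ξ k f = etaN ξ' k f := by
  have : ξ k = ξ' k := congr_fun h ⟨k, Finset.mem_Iic.2 hk⟩
  rw [etaN, etaN, this]

lemma massN_congr {N p q : ℕ} (hq : q ≤ p + 1) {ξ ξ' : Swarm E N}
    (h : frestrictLe (π := fun n => Fin N → Path E n) p ξ = frestrictLe p ξ') :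
    M.massN q ξ = M.massN q ξ' :=
  Finset.prod_congr rfl fun k hk =>
    etaN_congr (by have := Finset.mem_Ico.1 hk; omega) h _

lemma integral_particleLaw_congr {N : ℕ} {f g : Swarm E N → ℝ} (hf : Measurable f)
    (hg : Measurable g) (h : ∀ ξ : Swarm E N, (ξ 0 = fun _ => M.startPath) → f ξ = g ξ) :
    ∫ ξ, f ξ ∂M.particleLaw N = ∫ ξ, g ξ ∂M.particleLaw N := by
  refine integral_traj_congr hf hg fun ξ hξ => h ξ ?_
  have := congr_fun hξ ⟨0, by simp⟩
  exact this

/-- Conditioning the particle system on its first `p` steps. -/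
lemma integral_particleLaw_succ {N p : ℕ} {h : Swarm E N → (Fin N → Path E (p + 1)) → ℝ}
    (hm : BddMeasurable (Function.uncurry h))
    (hdep : ∀ ξ ξ' : Swarm E N,
      frestrictLe (π := fun n => Fin N → Path E n) p ξ = frestrictLe p ξ' → h ξ = h ξ') :
    ∫ ξ, h ξ (ξ (p + 1)) ∂M.particleLaw N
      = ∫ ξ, ∫ z, h ξ z ∂(Measure.pi fun _ => M.Phi p (empirical (ξ p))) ∂M.particleLaw N :=
  integral_traj_succ (X := fun n => Fin N → Path E n) (Nat.zero_le p) _ hm hdep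

/-- The one-step evolution of the unnormalized particle measures. -/
lemma massN_mul_integral_twist_succ {N : ℕ} (hN : N ≠ 0) (p : ℕ) (hF : BddMeasurable F)
    {ξ : Swarm E N} (hξ : ξ 0 = fun _ => M.startPath) :
    M.massN (p + 1) ξ * ∫ z, M.twist (p + 1) F z ∂M.Phi p (empirical (ξ p))
      = M.gammaN ξ p (M.twist p F) := by
  have hN' : (N : ℝ) ≠ 0 := by exact_mod_cast hN
  have hS : ∑ i, M.G p (ξ p i) ≠ 0 := (Finset.sum_pos (fun i _ => M.G_pos p _)
    ⟨⟨0, Nat.pos_of_ne_zero hN⟩, Finset.mem_univ _⟩).ne'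
  rw [integral_Phi_empirical p hN _ (bddMeasurable_twist (p + 1) hF), gammaN_eq,
    etaN_eq _ _ (bddMeasurable_twist p hF).measurable]
  -- At time `0` all particles coincide, so the dummy `G 0` cancels in the weights. For `p ≥ 1` the
  -- normalization is the factor `η_p^N(G_p)` newly present in `massN (p + 1)`.
  rcases Nat.eq_zero_or_pos p with rfl | hp
  · simp only [zero_add, hξ, integral_twist_one hF] at hS ⊢
    rw [← Finset.sum_mul, inv_mul_cancel_left₀ hS]
    simp [massN, hN']
  · simp only [G_mul_integral_twist_succ hp hF]
    have : M.massN (p + 1) ξ = M.massN p ξ * etaN ξ p (M.G p) := Finset.prod_Ico_succ_top hp _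
    rw [this, etaN_eq _ _ (M.measurable_G p)]
    field_simp

end Model

end RareEvent

/-! ### Martingale structure and moments of the unnormalized estimates -/

namespace RareEvent

namespace Model

open Preorder

variable {E : ℕ → Type*} [∀ n, MeasurableSpace (E n)] {M : Model E}
  {F F' : ((n : ℕ) → E n) → ℝ}

lemma bddMeasurable_integral_pi_Phi {N p : ℕ} {h : Swarm E N → (Fin N → Path E (p + 1)) → ℝ}
    (hm : BddMeasurable (Function.uncurry h)) :
    BddMeasurable fun ξ => ∫ z, h ξ z ∂(Measure.pi fun _ => M.Phi p (empirical (ξ p))) :=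
  hm.integral_kernel ((M.particleKernel N p).comap (fun ξ => ξ p) (measurable_pi_apply p))

lemma integral_particleLaw_succ_eq {N p : ℕ} {h : Swarm E N → (Fin N → Path E (p + 1)) → ℝ}
    (hm : BddMeasurable (Function.uncurry h))
    (hdep : ∀ ξ ξ' : Swarm E N,
      frestrictLe (π := fun n => Fin N → Path E n) p ξ = frestrictLe p ξ' → h ξ = h ξ')
    {g : Swarm E N → ℝ} (hg : Measurable g) (hhg : ∀ ξ : Swarm E N, (ξ 0 = fun _ => M.startPath) →
      ∫ z, h ξ z ∂(Measure.pi fun _ => M.Phi p (empirical (ξ p))) = g ξ) :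
    ∫ ξ, h ξ (ξ (p + 1)) ∂M.particleLaw N = ∫ ξ, g ξ ∂M.particleLaw N := by
  rw [integral_particleLaw_succ hm hdep]
  exact integral_particleLaw_congr (bddMeasurable_integral_pi_Phi hm).measurable hg hhg

lemma integral_particleLaw_succ_le {N p : ℕ} {h : Swarm E N → (Fin N → Path E (p + 1)) → ℝ}
    (hm : BddMeasurable (Function.uncurry h))
    (hdep : ∀ ξ ξ' : Swarm E N,
      frestrictLe (π := fun n => Fin N → Path E n) p ξ = frestrictLe p ξ' → h ξ = h ξ')
    {c : ℝ} (hc : ∀ ξ : Swarm E N, (ξ 0 = fun _ => M.startPath) →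
      ∫ z, h ξ z ∂(Measure.pi fun _ => M.Phi p (empirical (ξ p))) ≤ c) :
    ∫ ξ, h ξ (ξ (p + 1)) ∂M.particleLaw N ≤ c := by
  have hi := bddMeasurable_integral_pi_Phi (M := M) hm
  -- The bound is known only for swarms started at `x₀`. Truncating at `c` changes nothing there and
  -- makes the bound hold everywhere.
  rw [integral_particleLaw_succ_eq hm hdep (hi.measurable.min measurable_const)
    fun ξ hξ => (min_eq_left (hc ξ hξ)).symm]
  refine (integral_mono ((hi.integrable _).inf (integrable_const c)) (integrable_const c)
    fun ξ => min_le_right _ _).trans (by simp)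

/-- `γ_p^N` at the conditional expectation of `F` at time `p`. -/
noncomputable def martingaleN (M : Model E) {N : ℕ} (p : ℕ) (F : ((n : ℕ) → E n) → ℝ)
    (ξ : Swarm E N) : ℝ :=
  M.gammaN ξ p (M.twist p F)

lemma bddMeasurable_martingaleN (N p : ℕ) (hF : BddMeasurable F) :
    BddMeasurable (M.martingaleN p F : Swarm E N → ℝ) :=
  bddMeasurable_gammaN (bddMeasurable_twist p hF)

lemma martingaleN_congr {N p : ℕ} {ξ ξ' : Swarm E N}
    (h : frestrictLe (π := fun n => Fin N → Path E n) p ξ = frestrictLe p ξ') :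
    M.martingaleN p F ξ = M.martingaleN p F ξ' := by
  rw [martingaleN, martingaleN, gammaN_eq, gammaN_eq, etaN_congr le_rfl h,
    massN_congr (Nat.le_succ p) h]

lemma martingaleN_zero {N : ℕ} (hN : N ≠ 0) (hF : BddMeasurable F) {ξ : Swarm E N}
    (hξ : ξ 0 = fun _ => M.startPath) : M.martingaleN 0 F ξ = ∫ x, F x ∂M.law := by
  have hN' : (N : ℝ) ≠ 0 := by exact_mod_cast hN
  rw [martingaleN, gammaN_eq, etaN_eq _ _ (bddMeasurable_twist 0 hF).measurable, hξ]
  simp [massN, hN', twist, potential]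
  rfl

lemma martingaleN_succ {N : ℕ} (p : ℕ) (hF : BddMeasurable F) (ξ : Swarm E N) :
    M.martingaleN (p + 1) F ξ
      = M.massN (p + 1) ξ * ((N : ℝ)⁻¹ * ∑ i, M.twist (p + 1) F (ξ (p + 1) i)) := by
  rw [martingaleN, gammaN_eq, etaN_eq _ _ (bddMeasurable_twist (p + 1) hF).measurable, mul_comm]

/-- The twist of `potential (p + 1)` at time `p + 1` is `1`. This writes the random mass as a
martingale value, which closes the recursion for mixed moments. -/
lemma martingaleN_potential {N : ℕ} (hN : N ≠ 0) (p : ℕ) {ξ : Swarm E N}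
    (hξ : ξ 0 = fun _ => M.startPath) :
    M.martingaleN p (M.potential (p + 1)) ξ = M.massN (p + 1) ξ := by
  rw [martingaleN, ← massN_mul_integral_twist_succ hN p (M.bddMeasurable_potential _) hξ]
  have h1 : ∀ z, M.twist (p + 1) (M.potential (p + 1)) z = 1 := by
    intro z
    simpa using twist_mul_potential (M := M) (f := fun _ : Path E (p + 1) => 1) (.const 1) z
  have := M.isProbabilityMeasure_Phi_empirical p hN (ξ p)
  simp [h1]

lemma bddMeasurable_massN_mul_mean {N : ℕ} (p : ℕ) {f : Path E (p + 1) → ℝ}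
    (hf : BddMeasurable f) :
    BddMeasurable fun q : Swarm E N × (Fin N → Path E (p + 1)) =>
      M.massN (p + 1) q.1 * ((N : ℝ)⁻¹ * ∑ i, f (q.2 i)) :=
  ((M.bddMeasurable_massN N (p + 1)).comp measurable_fst).mul
    ((bddMeasurable_mean hf N).comp measurable_snd)

/-- The particle approximations are unbiased. -/
lemma integral_martingaleN {N : ℕ} (hN : N ≠ 0) (p : ℕ) (hF : BddMeasurable F) :
    ∫ ξ, M.martingaleN p F ξ ∂M.particleLaw N = ∫ x, F x ∂M.law := by
  induction p with
  | zero =>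
    rw [integral_particleLaw_congr (bddMeasurable_martingaleN N 0 hF).measurable
      measurable_const fun ξ hξ => martingaleN_zero hN hF hξ]
    simp
  | succ p ih =>
    rw [← ih]
    simp only [martingaleN_succ p hF]
    refine integral_particleLaw_succ_eq (h := fun ξ z =>
        M.massN (p + 1) ξ * ((N : ℝ)⁻¹ * ∑ i, M.twist (p + 1) F (z i)))
      (bddMeasurable_massN_mul_mean p (bddMeasurable_twist _ hF))
      (fun ξ ξ' h => by simp only [massN_congr le_rfl h])
      (bddMeasurable_martingaleN N p hF).measurable fun ξ hξ => ?_
    have := M.isProbabilityMeasure_Phi_empirical p hN (ξ p)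
    rw [integral_const_mul, integral_mean hN (bddMeasurable_twist _ hF),
      massN_mul_integral_twist_succ hN p hF hξ, martingaleN]

/-- A function of the trajectory whose twist at time `p` is the product of the twists of
`F` and `F'`. -/
noncomputable def crossTwist (M : Model E) (p : ℕ) (F F' : ((n : ℕ) → E n) → ℝ)
    (x : (n : ℕ) → E n) : ℝ :=
  (M.twist p F (frestrictLe p x) * M.twist p F' (frestrictLe p x)) * M.potential p x

lemma bddMeasurable_crossTwist (p : ℕ) (hF : BddMeasurable F) (hF' : BddMeasurable F') :
    BddMeasurable (M.crossTwist p F F') :=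
  (((bddMeasurable_twist p hF).mul (bddMeasurable_twist p hF')).comp
    (measurable_frestrictLe p)).mul (M.bddMeasurable_potential p)

lemma twist_crossTwist (p : ℕ) (hF : BddMeasurable F) (hF' : BddMeasurable F') (y : Path E p) :
    M.twist p (M.crossTwist p F F') y = M.twist p F y * M.twist p F' y :=
  twist_mul_potential ((bddMeasurable_twist p hF).mul (bddMeasurable_twist p hF')) y

/-- The mixed second moment of two unnormalized particle estimates. -/
noncomputable def mixedMoment (M : Model E) (N p : ℕ) (F F' : ((n : ℕ) → E n) → ℝ) : ℝ :=
  ∫ ξ, M.martingaleN p F ξ * M.martingaleN p F' ξ ∂M.particleLaw N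

lemma mixedMoment_zero {N : ℕ} (hN : N ≠ 0) (hF : BddMeasurable F) (hF' : BddMeasurable F') :
    M.mixedMoment N 0 F F' = (∫ x, F x ∂M.law) * ∫ x, F' x ∂M.law := by
  rw [mixedMoment, integral_particleLaw_congr ((bddMeasurable_martingaleN N 0 hF).mul
    (bddMeasurable_martingaleN N 0 hF')).measurable measurable_const fun ξ hξ => by
      rw [martingaleN_zero hN hF hξ, martingaleN_zero hN hF' hξ]]
  simp

/-- Given the past, a product of two empirical means splits into a diagonal and an off-diagonal
part. In the diagonal part, one factor of the squared mass is itself a martingale value; the other,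
times the mean of the product of twists, is the value for `crossTwist`. -/
lemma mixedMoment_succ {N : ℕ} (hN : N ≠ 0) (p : ℕ) (hF : BddMeasurable F)
    (hF' : BddMeasurable F') :
    M.mixedMoment N (p + 1) F F'
      = (N : ℝ)⁻¹ * M.mixedMoment N p (M.potential (p + 1)) (M.crossTwist (p + 1) F F')
        + (1 - (N : ℝ)⁻¹) * M.mixedMoment N p F F' := by
  have hU := bddMeasurable_martingaleN (M := M) N p hF
  have hU' := bddMeasurable_martingaleN (M := M) N p hF'
  have hc := bddMeasurable_crossTwist (M := M) (p + 1) hF hF'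
  have hUc := bddMeasurable_martingaleN (M := M) N p hc
  have hU1 := bddMeasurable_martingaleN (M := M) N p (M.bddMeasurable_potential (p + 1))
  have hm := (BddMeasurable.const (N : ℝ)⁻¹).mul (hU1.mul hUc)
  have hm' := (BddMeasurable.const (1 - (N : ℝ)⁻¹)).mul (hU.mul hU')
  simp only [mixedMoment]
  rw [← integral_const_mul, ← integral_const_mul,
    ← integral_add (hm.integrable _) (hm'.integrable _)]
  simp only [martingaleN_succ p hF, martingaleN_succ p hF']
  refine integral_particleLaw_succ_eq (h := fun ξ z =>
      M.massN (p + 1) ξ * ((N : ℝ)⁻¹ * ∑ i, M.twist (p + 1) F (z i)) *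
        (M.massN (p + 1) ξ * ((N : ℝ)⁻¹ * ∑ i, M.twist (p + 1) F' (z i))))
    ((bddMeasurable_massN_mul_mean p (bddMeasurable_twist _ hF)).mul
      (bddMeasurable_massN_mul_mean p (bddMeasurable_twist _ hF')))
    (fun ξ ξ' h => by simp only [massN_congr le_rfl h]) (hm.add hm').measurable fun ξ hξ => ?_
  have := M.isProbabilityMeasure_Phi_empirical p hN (ξ p)
  simp only [mul_mul_mul_comm (M.massN (p + 1) ξ)]
  rw [integral_const_mul, integral_mean_mul_mean hN (bddMeasurable_twist _ hF)
    (bddMeasurable_twist _ hF')]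
  simp only [← twist_crossTwist (p + 1) hF hF']
  rw [martingaleN_potential hN p hξ, martingaleN, martingaleN, martingaleN,
    ← massN_mul_integral_twist_succ hN p hF hξ, ← massN_mul_integral_twist_succ hN p hF' hξ,
    ← massN_mul_integral_twist_succ hN p hc hξ]
  ring

lemma tendsto_mixedMoment (p : ℕ) (hF : BddMeasurable F) (hF' : BddMeasurable F') :
    Tendsto (fun N : ℕ => M.mixedMoment N p F F') atTop
      (𝓝 ((∫ x, F x ∂M.law) * ∫ x, F' x ∂M.law)) := by
  induction p generalizing F F' with
  | zero =>
    refine tendsto_const_nhds.congr' ?_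
    filter_upwards [eventually_ne_atTop 0] with N hN
    exact (mixedMoment_zero hN hF hF').symm
  | succ p ih =>
    have h0 : Tendsto (fun N : ℕ => (N : ℝ)⁻¹) atTop (𝓝 0) :=
      tendsto_inv_atTop_zero.comp tendsto_natCast_atTop_atTop
    have h1 := h0.mul (ih (M.bddMeasurable_potential (p + 1))
      (bddMeasurable_crossTwist (M := M) (p + 1) hF hF'))
    have h2 := (h0.const_sub 1).mul (ih hF hF')
    have h3 := h1.add h2
    rw [zero_mul, zero_add, sub_zero, one_mul] at h3
    refine h3.congr' ?_
    filter_upwards [eventually_ne_atTop 0] with N hN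
    exact (mixedMoment_succ hN p hF hF').symm

/-- The asymptotic covariance of the unnormalized particle estimates. -/
lemma tendsto_mul_mixedMoment_sub (n : ℕ) (hF : BddMeasurable F) (hF' : BddMeasurable F') :
    Tendsto (fun N : ℕ => (N : ℝ) *
        (M.mixedMoment N n F F' - (∫ x, F x ∂M.law) * ∫ x, F' x ∂M.law)) atTop
      (𝓝 (∑ p ∈ Finset.range n, ((∫ x, M.potential (p + 1) x ∂M.law) *
        (∫ x, M.crossTwist (p + 1) F F' x ∂M.law) -
          (∫ x, F x ∂M.law) * ∫ x, F' x ∂M.law))) := by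
  induction n with
  | zero =>
    refine tendsto_const_nhds.congr' ?_
    filter_upwards [eventually_ne_atTop 0] with N hN
    simp [mixedMoment_zero hN hF hF']
  | succ n ih =>
    rw [Finset.sum_range_succ]
    refine (ih.add ((tendsto_mixedMoment n (M.bddMeasurable_potential (n + 1))
      (bddMeasurable_crossTwist (M := M) (n + 1) hF hF')).sub
        (tendsto_mixedMoment n hF hF'))).congr' ?_
    filter_upwards [eventually_ne_atTop 0] with N hN
    have hN' : (N : ℝ) ≠ 0 := by exact_mod_cast hN
    -- The recursion makes the increment of `N` times the covariance equal to the difference of two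
    -- mixed moments, whose limits are already known.
    rw [mixedMoment_succ hN n hF hF']
    field_simp
    ring

/-- Given the past, the increment is `massN (p + 1)` times a centred mean of i.i.d. variables, and
the mass is bounded uniformly in `N`. -/
lemma exists_integral_martingaleN_increment_pow_four_le (M : Model E) (p : ℕ)
    (hF : BddMeasurable F) :
    ∃ K : ℝ, ∀ N : ℕ, N ≠ 0 →
      ∫ ξ, (M.martingaleN (p + 1) F ξ - M.martingaleN p F ξ) ^ 4 ∂M.particleLaw N
        ≤ K * (N : ℝ)⁻¹ ^ 2 := by
  obtain ⟨C, hC⟩ := M.exists_abs_massN_le (p + 1)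
  have hq := bddMeasurable_twist (M := M) (p + 1) hF
  obtain ⟨D, hD⟩ := hq.bdd
  refine ⟨C ^ 4 * (48 * Real.exp (1 / 2) * (|D| + 1) ^ 4), fun N hN => ?_⟩
  simp only [martingaleN_succ p hF]
  refine integral_particleLaw_succ_le (h := fun ξ z =>
      (M.massN (p + 1) ξ * ((N : ℝ)⁻¹ * ∑ i, M.twist (p + 1) F (z i)) - M.martingaleN p F ξ) ^ 4)
    (((bddMeasurable_massN_mul_mean p hq).sub
      ((bddMeasurable_martingaleN N p hF).comp measurable_fst)).pow 4)
    (fun ξ ξ' h => by simp only [massN_congr le_rfl h, martingaleN_congr h]) fun ξ hξ => ?_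
  have := M.isProbabilityMeasure_Phi_empirical p hN (ξ p)
  simp only [martingaleN, ← massN_mul_integral_twist_succ hN p hF hξ, ← mul_sub, mul_pow]
  rw [integral_const_mul, mul_assoc]
  refine mul_le_mul ?_ (integral_mean_sub_pow_four_le hN (by positivity) hq.measurable
    fun y => (hD y).trans ((le_abs_self D).trans (by linarith)))
    (integral_nonneg fun z => by positivity) (by positivity)
  rw [← abs_of_nonneg (by positivity : 0 ≤ M.massN (p + 1) ξ ^ 4), abs_pow]
  exact pow_le_pow_left₀ (abs_nonneg _) (hC N ξ) 4

/-- Fourth central moments of the unnormalized particle estimates. -/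
lemma exists_integral_martingaleN_sub_pow_four_le (M : Model E) (p : ℕ) (hF : BddMeasurable F) :
    ∃ K : ℝ, ∀ N : ℕ, N ≠ 0 →
      ∫ ξ, (M.martingaleN p F ξ - ∫ x, F x ∂M.law) ^ 4 ∂M.particleLaw N
        ≤ K * (N : ℝ)⁻¹ ^ 2 := by
  induction p with
  | zero =>
    refine ⟨0, fun N hN => ?_⟩
    rw [integral_particleLaw_congr (((bddMeasurable_martingaleN N 0 hF).sub (.const _)).pow
      4).measurable (measurable_const (a := 0)) fun ξ hξ => by simp [martingaleN_zero hN hF hξ]]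
    simp
  | succ p ih =>
    obtain ⟨K, hK⟩ := ih
    obtain ⟨K', hK'⟩ := M.exists_integral_martingaleN_increment_pow_four_le p hF
    refine ⟨8 * K' + 8 * K, fun N hN => ?_⟩
    have hU := bddMeasurable_martingaleN (M := M) N p hF
    have hU' := bddMeasurable_martingaleN (M := M) N (p + 1) hF
    have h1 := ((BddMeasurable.const 8).mul ((hU'.sub hU).pow 4)).integrable (M.particleLaw N)
    have h2 := ((BddMeasurable.const 8).mul
      ((hU.sub (.const (∫ x, F x ∂M.law))).pow 4)).integrable (M.particleLaw N)
    calc _ ≤ ∫ ξ, (8 * (M.martingaleN (p + 1) F ξ - M.martingaleN p F ξ) ^ 4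
          + 8 * (M.martingaleN p F ξ - ∫ x, F x ∂M.law) ^ 4) ∂M.particleLaw N := by
          refine integral_mono (((hU'.sub (.const _)).pow 4).integrable _) (h1.add h2)
            fun ξ => ?_
          -- Convexity of the fourth power, the source of the factor `8 = 2³`.
          have h := Even.add_pow_le (n := 4) (by decide)
            (a := M.martingaleN (p + 1) F ξ - M.martingaleN p F ξ)
            (b := M.martingaleN p F ξ - ∫ x, F x ∂M.law)
          rw [sub_add_sub_cancel] at h
          exact h.trans_eq (by ring)
      _ ≤ 8 * (K' * (N : ℝ)⁻¹ ^ 2) + 8 * (K * (N : ℝ)⁻¹ ^ 2) := by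
          rw [integral_add h1 h2, integral_const_mul, integral_const_mul]
          linarith [hK N hN, hK' N hN]
      _ = _ := by ring

end Model

end RareEvent

/-! ### Identification of the limit -/

namespace RareEvent

namespace Model

open Preorder

variable {E : ℕ → Type*} [∀ n, MeasurableSpace (E n)] {M : Model E}
  {F F' : ((n : ℕ) → E n) → ℝ}

/-- The transition probabilities of the chain are the marginals of its conditional laws. -/
lemma map_eval_lawGiven (M : Model E) {p n : ℕ} (h : p ≤ n) (y : Path E p) :
    (M.lawGiven p y).map (fun x => x n) = M.transition h y.last := by
  induction n, h using Nat.le_induction with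
  | base =>
    have e : (fun x : (n : ℕ) → E n => x p) = Path.last ∘ frestrictLe p := rfl
    rw [e, ← Measure.map_map Path.measurable_last (by fun_prop), lawGiven,
      Kernel.traj_map_frestrictLe_apply, Kernel.partialTraj_self, Kernel.id_apply,
      Measure.map_dirac' Path.measurable_last, transition, Nat.leRec_self, Kernel.id_apply]
  | succ n h ih =>
    have hK : Measurable (fun w => M.K n w) := (M.K n).measurable
    ext s hs
    have h1 : (M.lawGiven p y).map (fun x => x (n + 1))
        = (M.stepKernel n ∘ₖ Kernel.partialTraj M.stepKernel p n) y := by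
      rw [lawGiven, ← Kernel.map_apply _ (measurable_pi_apply (n + 1)),
        ← Kernel.traj_comp_partialTraj h, Kernel.map_comp, Kernel.map_traj_succ_self]
    have hKs := (M.K n).measurable_coe hs
    rw [h1, transition, Nat.leRec_succ _ _ h, Kernel.comp_apply' _ _ _ hs,
      Kernel.comp_apply' _ _ _ hs, ← Kernel.traj_map_frestrictLe_apply,
      lintegral_map ((M.stepKernel n).measurable_coe hs) (by fun_prop)]
    change _ = ∫⁻ w, M.K n w s ∂M.transition h y.last
    rw [← ih, lintegral_map hKs (measurable_pi_apply n)]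
    rfl

lemma measurableSet_rareEvent {n : ℕ} {V : E n → ℝ} (hV : Measurable V) (a : ℝ) :
    MeasurableSet (rareEvent V a) :=
  measurableSet_le measurable_const (hV.comp (measurable_pi_apply n))

/-- The Markov property: the conditional probability given the whole path depends only on its last
point. -/
lemma probGiven_eq_integral (M : Model E) {p n : ℕ} (h : p ≤ n) {V : E n → ℝ}
    (hV : Measurable V) (a : ℝ) (y : Path E p) :
    M.probGiven h V a y.last
      = ∫ x, (rareEvent V a).indicator (fun _ => 1) x ∂M.lawGiven p y := by
  rw [probGiven, ← M.map_eval_lawGiven h y, map_measureReal_apply (measurable_pi_apply n)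
    (measurableSet_le measurable_const hV), integral_indicator_const _
    (measurableSet_rareEvent hV a), smul_eq_mul, mul_one]
  rfl

lemma gammaInv_eq (M : Model E) (p : ℕ) (f : Path E p → ℝ) :
    M.gammaInv p f = ∫ x, f (frestrictLe p x) * (M.potential p x)⁻¹ ∂M.law := by
  simp only [← inv_potential]
  rfl

lemma gammaInv_one_mul_etaInv (M : Model E) (p : ℕ) (f : Path E p → ℝ) :
    M.gammaInv p (fun _ => 1) * M.etaInv p f = M.gammaInv p f := by
  have h : 0 < M.gammaInv p (fun _ => 1) := by
    rw [gammaInv_eq]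
    simp only [one_mul]
    refine (integral_pos_iff_support_of_nonneg (fun x => (inv_pos.2 (M.potential_pos p x)).le)
      ((M.bddMeasurable_potential_inv p).integrable _)).2 ?_
    have : Function.support (fun x => (M.potential p x)⁻¹) = Set.univ :=
      Set.eq_univ_of_forall fun x => (inv_pos.2 (M.potential_pos p x)).ne'
    rw [this, measure_univ]
    exact one_pos
  exact mul_div_cancel₀ _ h.ne'

lemma gamma_one (M : Model E) (p : ℕ) : M.gamma p (fun _ => 1) = ∫ x, M.potential p x ∂M.law := by
  simp only [gamma, one_mul]
  rfl

lemma integral_crossTwist (p : ℕ) (hF : BddMeasurable F) (hF' : BddMeasurable F') :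
    ∫ x, M.crossTwist p F F' x ∂M.law = M.gammaInv p fun y =>
      (∫ x, F x ∂M.lawGiven p y) * ∫ x, F' x ∂M.lawGiven p y := by
  rw [gammaInv_eq]
  congr 1 with x
  have := (M.potential_pos p x).ne'
  rw [crossTwist, twist_frestrictLe p hF, twist_frestrictLe p hF']
  field_simp

/-! ### The weighted estimators as martingale values -/

section Weight

variable {n : ℕ} {V : E n → ℝ} {a : ℝ} {φ : Path E n → ℝ}

lemma weight_frestrictLe (M : Model E) (V : E n → ℝ) (a : ℝ) (φ : Path E n → ℝ)
    (x : (n : ℕ) → E n) :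
    M.weight V a φ (frestrictLe n x)
      = (rareEvent V a).indicator (fun x => φ (frestrictLe n x)) x * (M.potential n x)⁻¹ := by
  have h1 : ∏ p : Finset.Ico 1 n,
      (M.G p (Path.trunc (Finset.mem_Ico.1 p.2).2.le (frestrictLe n x)))⁻¹
        = (M.potential n x)⁻¹ := by
    rw [potential, ← Finset.prod_inv_distrib,
      ← Finset.prod_coe_sort (Finset.Ico 1 n) fun k => (M.G k (frestrictLe k x))⁻¹]
    rfl
  rw [weight, h1]
  rfl

lemma bddMeasurable_weight (M : Model E) (hV : Measurable V) (a : ℝ) (hφ : BddMeasurable φ) :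
    BddMeasurable (M.weight V a φ) :=
  (hφ.indicator (measurableSet_le measurable_const (hV.comp Path.measurable_last))).mul
    (BddMeasurable.prod _ fun p _ => (M.inv.bddMeasurable_G p).comp
      (measurable_frestrictLe₂ (X := E) (Finset.mem_Ico.1 p.2).2.le))

lemma weight_one_nonneg (M : Model E) (V : E n → ℝ) (a : ℝ) (y : Path E n) :
    0 ≤ M.weight V a (fun _ => 1) y :=
  mul_nonneg (Set.indicator_nonneg (fun _ _ => zero_le_one) y)
    (Finset.prod_nonneg fun _ _ => (inv_pos.2 (M.G_pos _ _)).le)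

lemma abs_weight_le (M : Model E) (V : E n → ℝ) (a : ℝ) {C : ℝ} (hC : ∀ y, |φ y| ≤ C)
    (y : Path E n) : |M.weight V a φ y| ≤ C * M.weight V a (fun _ => 1) y := by
  have hp : 0 ≤ ∏ p : Finset.Ico 1 n, (M.G p (y.trunc (Finset.mem_Ico.1 p.2).2.le))⁻¹ :=
    Finset.prod_nonneg fun _ _ => (inv_pos.2 (M.G_pos _ _)).le
  rw [weight, weight, abs_mul, abs_of_nonneg hp, ← mul_assoc]
  refine mul_le_mul_of_nonneg_right ?_ hp
  by_cases hy : y ∈ {y : Path E n | a ≤ V y.last}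
  · simpa [hy] using hC y
  · simp [hy]

lemma weight_sub_const (M : Model E) (V : E n → ℝ) (a c : ℝ) (y : Path E n) :
    M.weight V a (fun y => φ y - c) y
      = M.weight V a φ y - c * M.weight V a (fun _ => 1) y := by
  rw [weight, weight, weight]
  by_cases hy : y ∈ {y : Path E n | a ≤ V y.last}
  · simp only [Set.indicator_of_mem hy]
    ring
  · simp [hy]

/-- The weight times the potential is the functional itself, so its twist at the final time is the
weight. -/
lemma martingaleN_indicator (M : Model E) (hV : Measurable V) (a : ℝ) (hφ : BddMeasurable φ)
    {N : ℕ} (ξ : Swarm E N) :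
    M.martingaleN n ((rareEvent V a).indicator fun x => φ (frestrictLe n x)) ξ
      = M.gammaN ξ n (M.weight V a φ) := by
  have h : (rareEvent V a).indicator (fun x => φ (frestrictLe n x))
      = fun x => M.weight V a φ (frestrictLe n x) * M.potential n x := by
    ext x
    rw [weight_frestrictLe, inv_mul_cancel_right₀ (M.potential_pos n x).ne']
  rw [martingaleN, h]
  congr 1 with y
  exact twist_mul_potential (M.bddMeasurable_weight hV a hφ) y

lemma massN_nonneg {N : ℕ} (p : ℕ) (ξ : Swarm E N) : 0 ≤ M.massN p ξ := by
  refine Finset.prod_nonneg fun k _ => ?_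
  rw [etaN_eq _ _ (M.measurable_G k)]
  exact mul_nonneg (by positivity) (Finset.sum_nonneg fun i _ => (M.G_pos k _).le)

lemma probN_nonneg (M : Model E) (hV : Measurable V) (a : ℝ) {N : ℕ} (ξ : Swarm E N) :
    0 ≤ M.probN V a ξ := by
  rw [probN, gammaN_eq, etaN_eq _ _ (M.bddMeasurable_weight hV a (.const 1)).measurable]
  exact mul_nonneg (mul_nonneg (by positivity)
    (Finset.sum_nonneg fun i _ => M.weight_one_nonneg V a _)) (massN_nonneg n ξ)

lemma abs_gammaN_weight_le (M : Model E) (hV : Measurable V) (a : ℝ) (hφ : BddMeasurable φ)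
    {C : ℝ} (hC : ∀ y, |φ y| ≤ C) {N : ℕ} (ξ : Swarm E N) :
    |M.gammaN ξ n (M.weight V a φ)| ≤ C * M.probN V a ξ := by
  rw [probN, gammaN_eq, gammaN_eq, etaN_eq _ _ (M.bddMeasurable_weight hV a hφ).measurable,
    etaN_eq _ _ (M.bddMeasurable_weight hV a (.const 1)).measurable, abs_mul,
    abs_of_nonneg (massN_nonneg n ξ), ← mul_assoc, abs_mul,
    abs_of_nonneg (by positivity : (0 : ℝ) ≤ (N : ℝ)⁻¹)]
  refine mul_le_mul_of_nonneg_right ?_ (massN_nonneg n ξ)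
  rw [mul_left_comm, Finset.mul_sum]
  gcongr
  exact (Finset.abs_sum_le_sum_abs _ _).trans
    (Finset.sum_le_sum fun i _ => M.abs_weight_le V a hC _)

/-- Numerator and denominator share the factor `massN`. When `probN` vanishes, division by zero
returns `0`, as does the indicator. -/
lemma indicator_condMeanN_sub (M : Model E) (hV : Measurable V) (a : ℝ) (hφ : BddMeasurable φ)
    (c : ℝ) {N : ℕ} (ξ : Swarm E N) :
    {ξ : Swarm E N | 0 < M.probN V a ξ}.indicator (fun ξ => M.condMeanN V a φ ξ - c) ξ
      = M.gammaN ξ n (M.weight V a fun y => φ y - c) / M.probN V a ξ := by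
  rcases (M.probN_nonneg hV a ξ).eq_or_lt with h | h
  · simp [← h]
  · have hw := (M.bddMeasurable_weight hV a hφ).measurable
    have hw1 := (M.bddMeasurable_weight hV a (.const 1)).measurable
    have hwc := (M.bddMeasurable_weight hV a (hφ.sub (.const c))).measurable
    have hlin : etaN ξ n (M.weight V a fun y => φ y - c)
        = etaN ξ n (M.weight V a φ) - c * etaN ξ n (M.weight V a fun _ => 1) := by
      rw [etaN_eq _ _ hwc, etaN_eq _ _ hw, etaN_eq _ _ hw1]
      simp only [weight_sub_const, Finset.sum_sub_distrib, ← Finset.mul_sum]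
      ring
    rw [Set.indicator_of_mem (show ξ ∈ {ξ : Swarm E N | 0 < M.probN V a ξ} from h), condMeanN]
    rw [probN, gammaN_eq] at h ⊢
    have h1 := left_ne_zero_of_mul h.ne'
    have h2 := right_ne_zero_of_mul h.ne'
    rw [gammaN_eq, hlin, mul_div_mul_right _ _ h2, sub_div, mul_div_cancel_right₀ _ h1]

lemma integral_indicator_sub_condMean (M : Model E) (hV : Measurable V) (ha : 0 < M.prob V a)
    (hφ : BddMeasurable φ) :
    ∫ x, (rareEvent V a).indicator (fun x => φ (frestrictLe n x) - M.condMean V a φ) x ∂M.law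
      = 0 := by
  have hi : Integrable (fun x => φ (frestrictLe n x)) M.law :=
    (hφ.comp (measurable_frestrictLe n)).integrable _
  rw [integral_indicator (measurableSet_rareEvent hV a),
    integral_sub hi.integrableOn (integrable_const _), setIntegral_const, condMean,
    ProbabilityTheory.cond, integral_smul_measure, smul_eq_mul, smul_eq_mul, ENNReal.toReal_inv]
  change _ - M.prob V a * ((M.prob V a)⁻¹ * _) = 0
  rw [mul_inv_cancel_left₀ ha.ne', sub_self]

end Weight

end Model

end RareEvent

/-! ### The main theorem -/

open RareEvent RareEvent.Model in
theorem theorem2p5 {E : ℕ → Type*} [∀ n, MeasurableSpace (E n)] (M : RareEvent.Model E)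
    {n : ℕ} (hn : 1 ≤ n) (V : E n → ℝ) (hV : Measurable V) (a : ℝ) (ha : 0 < M.prob V a)
    (φ : RareEvent.Path E n → ℝ) (hφ : Measurable φ) (hφb : ∃ C : ℝ, ∀ y, |φ y| ≤ C) :
    Tendsto
      (fun N : ℕ => (N : ℝ) * ∫ ξ, {ξ : RareEvent.Model.Swarm E N | 0 < M.probN V a ξ}.indicator
        (fun ξ => M.condMeanN V a φ ξ - M.condMean V a φ) ξ ∂(M.particleLaw N))
      atTop
      (𝓝 (-((M.prob V a) ^ 2)⁻¹ * ∑ p : Finset.Icc 1 n,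
        M.gamma p (fun _ => 1) * M.gammaInv p (fun _ => 1) *
          M.etaInv p (fun y => M.probGiven (Finset.mem_Icc.1 p.2).2 V a y.last *
            M.centredGiven p V a φ y))) := by
  have hφ' : BddMeasurable φ := ⟨hφ, hφb⟩
  have hψ : BddMeasurable fun y => φ y - M.condMean V a φ := hφ'.sub (.const _)
  obtain ⟨C, hC⟩ := hψ.bdd
  have hA := measurableSet_rareEvent hV a
  have hF : BddMeasurable ((rareEvent V a).indicator
      fun x => φ (Preorder.frestrictLe n x) - M.condMean V a φ) :=
    (hψ.comp (Preorder.measurable_frestrictLe n)).indicator hA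
  have hF' : BddMeasurable ((rareEvent V a).indicator fun _ => (1 : ℝ)) :=
    (BddMeasurable.const 1).indicator hA
  have hF0 := M.integral_indicator_sub_condMean hV ha hφ'
  have hF1 : ∫ x, (rareEvent V a).indicator (fun _ => (1 : ℝ)) x ∂M.law = M.prob V a := by
    rw [integral_indicator_const _ hA, smul_eq_mul, mul_one, prob]
  have hnum : ∀ (N : ℕ) (ξ : Swarm E N), M.gammaN ξ n (M.weight V a fun y => φ y - M.condMean V a φ)
      = M.martingaleN n ((rareEvent V a).indicator
          fun x => φ (Preorder.frestrictLe n x) - M.condMean V a φ) ξ :=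
    fun N ξ => (M.martingaleN_indicator hV a hψ ξ).symm
  have hden : ∀ (N : ℕ) (ξ : Swarm E N), M.probN V a ξ
      = M.martingaleN n ((rareEvent V a).indicator fun _ => (1 : ℝ)) ξ :=
    fun N ξ => (M.martingaleN_indicator hV a (φ := fun _ => 1) (.const 1) ξ).symm
  simp only [M.indicator_condMeanN_sub hV a hφ']
  have hle : ∀ (N : ℕ) (ξ : Swarm E N),
      |M.gammaN ξ n (M.weight V a fun y => φ y - M.condMean V a φ)| ≤ |C| * M.probN V a ξ :=
    fun N ξ => M.abs_gammaN_weight_le hV a hψ (fun y => (hC y).trans (le_abs_self C)) ξ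
  have hpos : ∀ (N : ℕ) (ξ : Swarm E N), 0 ≤ M.probN V a ξ := fun N ξ => M.probN_nonneg hV a ξ
  simp only [hnum, hden] at hle hpos ⊢
  obtain ⟨K, hK⟩ := M.exists_integral_martingaleN_sub_pow_four_le n hF
  obtain ⟨K', hK'⟩ := M.exists_integral_martingaleN_sub_pow_four_le n hF'
  rw [hF0] at hK
  rw [hF1] at hK'
  refine tendsto_mul_integral_ratio (K := max K K')
    (fun N => bddMeasurable_martingaleN N n hF) (fun N => bddMeasurable_martingaleN N n hF')
    (abs_nonneg C) ha hpos hle ?_ ?_ ?_ ?_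
  · filter_upwards [eventually_ne_atTop 0] with N hN
    rw [integral_martingaleN hN n hF, hF0]
  · filter_upwards [eventually_ne_atTop 0] with N hN
    have := hK N hN
    simp only [sub_zero] at this
    exact this.trans (by gcongr; exact le_max_left _ _)
  · filter_upwards [eventually_ne_atTop 0] with N hN
    exact (hK' N hN).trans (by gcongr; exact le_max_right _ _)
  · have hlim := tendsto_mul_mixedMoment_sub (M := M) n hF hF'
    -- Centring of the numerator removes the product of means from every summand.
    simp only [hF0, zero_mul, sub_zero] at hlim
    convert! hlim using 2
    rw [Finset.range_eq_Ico, Finset.sum_Ico_add' (fun p => (∫ x, M.potential p x ∂M.law) *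
      ∫ x, M.crossTwist p _ _ x ∂M.law), zero_add]
    change _ = ∑ p ∈ Finset.Icc 1 n, _
    rw [← Finset.sum_coe_sort (Finset.Icc 1 n)]
    refine Finset.sum_congr rfl fun p _ => ?_
    rw [mul_assoc, gammaInv_one_mul_etaInv, gamma_one, integral_crossTwist _ hF hF']
    congr 2 with y
    rw [M.probGiven_eq_integral _ hV, mul_comm]
    rfl
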